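/- Let $(X,\mathsf d)$ be a complete separable metric space, $\mathfrak m$ a Borel probability measure on $X$, $K\in\mathbb R$ and $N\in(1,\infty)$. **Notation.** $\mathrm{Geo}(X)$ is the set of $\gamma:[0,1]\to X$ with $\mathsf d(\gamma_s,\gamma_t)=|s-t|\,\mathsf d(\gamma_0,\gamma_1)$ for all $s,t$, with the uniform topology, and $e_t(\gamma)=\gamma_t$. $\mathrm{OptGeo}(\mu_0,\mu_1)$ is the set of Borel probability measures $\nu$ on $\mathrm{Geo}(X)$ such that $t\mapsto (e_t)_\sharp\nu$ is a constant-speed geodesic in $(\mathcal P_2(X),W_2)$ from $\mu_0$ to $\mu_1$. $\mathcal P_2(X,\mathsf d,\mathfrak m)$ is the set of $\mu\in\mathcal P_2(X)$ with $\mu\ll\mathfrak m$. For real $\mathcal N>0$, $t\in[0,1]$, $\theta\ge 0$, set $\sigma^{(t)}_{K,\mathcal N}(\theta)=\frac{\sin(t\theta\sqrt{K/\mathcal N})}{\sin(\theta\sqrt{K/\mathcal N})}$ if $K>0$ and $0<\theta<\pi/\sqrt{K/\mathcal N}$, $=+\infty$ if $K>0$ and $\theta\ge\pi/\sqrt{K/\mathcal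 N}$, $=\frac{\sinh(t\theta\sqrt{-K/\mathcal N})}{\sinh(\theta\sqrt{-K/\mathcal N})}$ if $K<0$ and $\theta>0$, and $=t$ if $K=0$ or $\theta=0$. Put $\tau^{(t)}_{K,N}(\theta)=t^{1/N}\sigma^{(t)}_{K,N-1}(\theta)^{1-1/N}$ (with $0\cdot\infty=0$) and $\mathcal E_N(\mu)=\int\rho^{1-1/N}\,d\mathfrak m$, where $\rho$ is the density of the absolutely continuous part of $\mu$ with respect to $\mathfrak m$. $B(o,r)$ is the open ball. **$\mathsf{CD}(K,N)$**: for all $\mu_i=\rho_i\mathfrak m\in\mathcal P_2(X,\mathsf d,\mathfrak m)$, $i=0,1$, there is $\nu\in\mathrm{OptGeo}(\mu_0,\mu_1)$ such that for all $t\in[0,1]$, $\mu_t:=(e_t)_\sharp\nu\ll\mathfrak m$ and, for all real $N'\ge N$, $\mathcal E_{N'}(\mu_t)\ge\int \big(\tau^{(1-t)}_{K,N'}(\mathsf d(x_0,x_1))\rho_0^{-1/N'}(x_0)+\tau^{(t)}_{K,N'}(\mathsf d(x_0,x_1))\rho_1^{-1/N'}(x_1)\big)\,(e_0,e_1)_\sharp\nu(dx_0,dx_1)$.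 **$\mathsf{MCP}(K,N)$ with respect to $o\in\mathrm{supp}(\mathfrak m)$**: for every Borel $A$ with $0<\mathfrak m(A)<\infty$ such that $\mu_0:=\mathfrak m\llcorner_A/\mathfrak m(A)\in\mathcal P_2(X)$ (and $A\subset B(o,\pi\sqrt{(N-1)/K})$ if $K>0$) there is $\nu\in\mathrm{OptGeo}(\mu_0,\delta_o)$ with $\frac{1}{\mathfrak m(A)}\mathfrak m\ge (e_t)_\sharp\big(\tau^{(1-t)}_{K,N}(\mathsf d(\gamma_0,\gamma_1))^N\nu(d\gamma)\big)$ for all $t\in[0,1]$. **$\mathsf{MCP}_\varepsilon(K,N)$**: for all $o\in\mathrm{supp}(\mathfrak m)$ and $\mu_0=\rho_0\mathfrak m\in\mathcal P_2(X,\mathsf d,\mathfrak m)$ of bounded support (contained in $B(o,\pi\sqrt{(N-1)/K})$ if $K>0$) there is $\nu\in\mathrm{OptGeo}(\mu_0,\delta_o)$ such that for all $t\in[0,1)$, $\mu_t:=(e_t)_\sharp\nu$ satisfies $\mathrm{supp}(\mu_t)\subset\mathrm{supp}(\mathfrak m)$ and $\mathcal E_N(\mu_t)\ge\int_X\tau^{(1-t)}_{K,N}(\mathsf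 d(x,o))\rho_0(x)^{1-1/N}\,\mathfrak m(dx)$. **Transport rays.** For a $1$-Lipschitz $u$ write $y\le_u x$ if $u(x)-u(y)=\mathsf d(x,y)$, and let $\mathcal T_u$ be the set of points $x$ for which there is $y\ne x$ with $|u(x)-u(y)|=\mathsf d(x,y)$. A transport ray is a maximal chain for $\le_u$ that is isometric to a closed interval of $\mathbb R$ of positive, possibly infinite, length. **$\mathsf{CD}^1_u$, $\mathsf{MCP}^1_u$** (when $\mathrm{supp}(\mathfrak m)=X$). $\mathsf{CD}^1_u(K,N)$ holds if there are a (not necessarily disjoint) family $\{X_\alpha\}_{\alpha\in Q}$ of subsets of $X$, a measure space $(Q,\mathfrak q)$ and Borel probability measures $\mathfrak m_\alpha$ on $X$ such that $\alpha\mapsto\mathfrak m_\alpha(B)$ is $\mathfrak q$-measurable and $\mathfrak m(B\cap\mathcal T_u)=\int_Q\mathfrak m_\alpha(B)\,\mathfrak q(d\alpha)$ for every Borel $B$, and for $\mathfrak q$-a.e. $\alpha$: $\mathfrak m_\alpha(X_\alpha)=1$, $X_\alpha$ is a transport ray, $\mathrm{supp}(\mathfrak m_\alpha)=X_\alpha$,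 and $(X_\alpha,\mathsf d,\mathfrak m_\alpha)$ satisfies $\mathsf{CD}(K,N)$. For $u=\mathsf d(\cdot,o)$, $\mathsf{MCP}^1_u(K,N)$ is the same with the last requirement replaced by: $o\in X_\alpha$ and $(X_\alpha,\mathsf d,\mathfrak m_\alpha)$ satisfies $\mathsf{MCP}(K,N)$ with respect to $o$. **$\mathsf{MCP}^1$, $\mathsf{CD}^1_{Lip}$, $\mathsf{CD}^1$.** $(X,\mathsf d,\mathfrak m)$ satisfies $\mathsf{MCP}^1(K,N)$ if $(\mathrm{supp}(\mathfrak m),\mathsf d,\mathfrak m)$ satisfies $\mathsf{MCP}^1_u(K,N)$ for all $u=\mathsf d(\cdot,o)$, $o\in\mathrm{supp}(\mathfrak m)$; it satisfies $\mathsf{CD}^1_{Lip}(K,N)$ if $(\mathrm{supp}(\mathfrak m),\mathsf d,\mathfrak m)$ satisfies $\mathsf{CD}^1_u(K,N)$ for all $1$-Lipschitz $u$ on $\mathrm{supp}(\mathfrak m)$; it satisfies $\mathsf{CD}^1(K,N)$ if this holds for all $u=d_f:=\mathrm{sgn}(f)\,\mathrm{dist}(\cdot,\{f=0\})$ with $f$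 continuous on $\mathrm{supp}(\mathfrak m)$, $\{f=0\}\ne\emptyset$, and $d_f$ $1$-Lipschitz. **Proposition.** If $(X,\mathsf d,\mathfrak m)$ satisfies $\mathsf{MCP}^1(K,N)$, then it satisfies $\mathsf{MCP}_\varepsilon(K,N)$. Moreover, each of $\mathsf{CD}^1(K,N)$ and $\mathsf{CD}^1_{Lip}(K,N)$ implies $\mathsf{MCP}^1(K,N)$, and hence $\mathsf{MCP}_\varepsilon(K,N)$. No non-branching assumption is made. -/

import Mathlib

open MeasureTheory
open scoped ENNReal

universe u

namespace MMS

noncomputable section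

/-! ### Geodesics and optimal dynamical plans -/

/-- `Geo X`: constant-speed geodesics `γ : [0,1] → X`, that is
`d(γ s, γ t) = |s - t| d(γ 0, γ 1)` for all `s, t`. Such maps are automatically continuous. -/
def Geo (X : Type u) [MetricSpace X] : Type u :=
  {γ : C(unitInterval, X) //
    ∀ s t : unitInterval, dist (γ s) (γ t) = |(s : ℝ) - (t : ℝ)| * dist (γ 0) (γ 1)}

/-- `Geo X` carries the topology of uniform convergence (the compact-open topology of
`C([0,1], X)` restricted to geodesics). -/
instance (X : Type u) [MetricSpace X] : TopologicalSpace (Geo X) :=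
  instTopologicalSpaceSubtype

/-- `Geo X` carries its Borel sigma-algebra. -/
instance (X : Type u) [MetricSpace X] : MeasurableSpace (Geo X) := borel (Geo X)

instance (X : Type u) [MetricSpace X] : BorelSpace (Geo X) := ⟨rfl⟩

/-- The evaluation map `e_t(γ) = γ t`. -/
def Geo.eval {X : Type u} [MetricSpace X] (t : unitInterval) (γ : Geo X) : X := γ.1 t

/-- `μ` belongs to `P₂(X)`: a Borel probability measure with finite second moment. -/
def IsP2 {X : Type u} [MetricSpace X] [MeasurableSpace X] (μ : Measure X) : Prop :=
  IsProbabilityMeasure μ ∧ ∃ x₀ : X, ∫⁻ x, edist x x₀ ^ 2 ∂μ < ∞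

/-- `μ` belongs to `P₂(X, d, 𝔪)`: moreover `μ ≪ 𝔪`. -/
def IsP2ac {X : Type u} [MetricSpace X] [MeasurableSpace X] (m μ : Measure X) : Prop :=
  IsP2 μ ∧ μ ≪ m

/-- The Wasserstein distance `W₂`: the square root of the infimum of `∫ d(x,y)² dπ` over all
transference plans `π` with marginals `μ₀` and `μ₁`. -/
def W2 {X : Type u} [MetricSpace X] [MeasurableSpace X] (μ₀ μ₁ : Measure X) : ℝ≥0∞ :=
  (⨅ π : {π : Measure (X × X) // π.map Prod.fst = μ₀ ∧ π.map Prod.snd = μ₁},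
    ∫⁻ z, edist z.1 z.2 ^ 2 ∂(π : Measure (X × X))) ^ (1 / 2 : ℝ)

/-- `OptGeo(μ₀, μ₁)`: probability measures `ν` on `Geo X` such that `t ↦ (e_t)_# ν` is a
(constant-speed) geodesic in `(P₂(X), W₂)` from `μ₀` to `μ₁`. -/
def OptGeo {X : Type u} [MetricSpace X] [MeasurableSpace X] (μ₀ μ₁ : Measure X) :
    Set (Measure (Geo X)) :=
  {ν | IsProbabilityMeasure ν ∧
    (∀ t : unitInterval, IsP2 (ν.map (Geo.eval t))) ∧
    (∀ s t : unitInterval, W2 (ν.map (Geo.eval s)) (ν.map (Geo.eval t)) =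
      ENNReal.ofReal |(s : ℝ) - (t : ℝ)| * W2 (ν.map (Geo.eval 0)) (ν.map (Geo.eval 1))) ∧
    ν.map (Geo.eval 0) = μ₀ ∧ ν.map (Geo.eval 1) = μ₁}

/-! ### Distortion coefficients and entropy -/

/-- The coefficients `σ_{K,𝒩}^{(t)}(θ)` for real `𝒩 > 0`, `t ∈ [0,1]`, `θ ≥ 0`. The value is `t`
at `θ = 0`, and `+∞` when `K > 0` and `θ ≥ π / √(K/𝒩)`. -/
def sigmaCoeff (K 𝒩 t θ : ℝ) : ℝ≥0∞ :=
  if θ = 0 ∨ K = 0 then ENNReal.ofReal t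
  else if 0 < K then
    if θ < Real.pi / √(K / 𝒩) then
      ENNReal.ofReal (Real.sin (t * θ * √(K / 𝒩)) / Real.sin (θ * √(K / 𝒩)))
    else ∞
  else ENNReal.ofReal (Real.sinh (t * θ * √(-K / 𝒩)) / Real.sinh (θ * √(-K / 𝒩)))

/-- The coefficients `τ_{K,N}^{(t)}(θ) = t^{1/N} σ_{K,N-1}^{(t)}(θ)^{1-1/N}` for `N ∈ (1,∞)`. -/
def tauCoeff (K N t θ : ℝ) : ℝ≥0∞ :=
  ENNReal.ofReal t ^ (1 / N) * sigmaCoeff K (N - 1) t θ ^ (1 - 1 / N)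

/-- The `N`-Rényi relative entropy `∫ ρ^{1-1/N} d𝔪`, where `ρ` is the density of the absolutely
continuous part of `μ` in its Lebesgue decomposition with respect to `𝔪`. -/
def renyi {X : Type u} [MeasurableSpace X] (N : ℝ) (m μ : Measure X) : ℝ≥0∞ :=
  ∫⁻ x, μ.rnDeriv m x ^ (1 - 1 / N) ∂m

/-! ### The conditions `CD`, `MCP` and `MCP_ε` -/

/-- The curvature-dimension condition `CD(K,N)`, for `N ∈ (1,∞)`. -/
def CD {X : Type u} [MetricSpace X] [MeasurableSpace X] (K N : ℝ) (m : Measure X) : Prop :=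
  ∀ μ₀ μ₁ : Measure X, IsP2ac m μ₀ → IsP2ac m μ₁ →
    ∃ ν ∈ OptGeo μ₀ μ₁, ∀ t : unitInterval,
      ν.map (Geo.eval t) ≪ m ∧
      ∀ N' : ℝ, N ≤ N' →
        ∫⁻ z, (tauCoeff K N' (1 - t) (dist z.1 z.2) * μ₀.rnDeriv m z.1 ^ (-(1 / N')) +
            tauCoeff K N' t (dist z.1 z.2) * μ₁.rnDeriv m z.2 ^ (-(1 / N')))
          ∂(ν.map fun γ => (Geo.eval 0 γ, Geo.eval 1 γ)) ≤
        renyi N' m (ν.map (Geo.eval t))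

/-- The measure contraction property `MCP(K,N)` with respect to the point `o ∈ supp 𝔪`, for
`N ∈ (1,∞)`. -/
def MCPAt {X : Type u} [MetricSpace X] [MeasurableSpace X] (K N : ℝ) (m : Measure X) (o : X) :
    Prop :=
  o ∈ m.support ∧
  ∀ A : Set X, MeasurableSet A → 0 < m A → m A < ∞ →
    (0 < K → A ⊆ Metric.ball o (Real.pi * √((N - 1) / K))) →
    IsP2 ((m A)⁻¹ • m.restrict A) →
    ∃ ν ∈ OptGeo ((m A)⁻¹ • m.restrict A) (Measure.dirac o), ∀ t : unitInterval,
      (ν.withDensity fun γ =>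
          tauCoeff K N (1 - t) (dist (Geo.eval 0 γ) (Geo.eval 1 γ)) ^ N).map (Geo.eval t) ≤
        (m A)⁻¹ • m

/-- The measure contraction property `MCP_ε(K,N)`, for `N ∈ (1,∞)`. -/
def MCPeps {X : Type u} [MetricSpace X] [MeasurableSpace X] (K N : ℝ) (m : Measure X) : Prop :=
  ∀ o ∈ m.support, ∀ μ₀ : Measure X, IsP2ac m μ₀ → Bornology.IsBounded μ₀.support →
    (0 < K → μ₀.support ⊆ Metric.ball o (Real.pi * √((N - 1) / K))) →
    ∃ ν ∈ OptGeo μ₀ (Measure.dirac o), ∀ t : unitInterval, t < 1 →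
      (ν.map (Geo.eval t)).support ⊆ m.support ∧
      ∫⁻ x, tauCoeff K N (1 - t) (dist x o) * μ₀.rnDeriv m x ^ (1 - 1 / N) ∂m ≤
        renyi N m (ν.map (Geo.eval t))

/-! ### Transport rays and disintegrations -/

/-- The relation `Γ_u`: `(x, y) ∈ Γ_u` iff `u x - u y = d(x, y)`; equivalently `y ≤_u x`. -/
def Gam {X : Type u} [MetricSpace X] (u : X → ℝ) (x y : X) : Prop :=
  u x - u y = dist x y

/-- The transport set `T_u`: the first projection of `(Γ_u ∪ Γ_u⁻¹) \ {x = y}`. -/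
def transportSet {X : Type u} [MetricSpace X] (u : X → ℝ) : Set X :=
  {x | ∃ y, y ≠ x ∧ (Gam u x y ∨ Gam u y x)}

/-- A transport ray: a maximal chain for `≤_u` that is isometric to a closed interval of `ℝ` of
positive, possibly infinite, length. -/
def IsTransportRay {X : Type u} [MetricSpace X] (u : X → ℝ) (R : Set X) : Prop :=
  IsMaxChain (Gam u) R ∧
    ∃ I : Set ℝ, IsClosed I ∧ I.OrdConnected ∧ I.Nontrivial ∧ Nonempty (I ≃ᵢ R)

/-- `(Q, q)` and `α ↦ mα α` form a disintegration of `𝔪` restricted to `T_u` on the family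
`{Xα α}`, where for almost every `α` the set `Xα α` is a transport ray and the support of
`mα α`. The family is not assumed to be disjoint. -/
structure IsRayDisintegration {X : Type u} [MetricSpace X] [MeasurableSpace X] (m : Measure X)
    (u : X → ℝ) {Q : Type u} [MeasurableSpace Q] (q : Measure Q) (Xα : Q → Set X)
    (mα : Q → Measure X) : Prop where
  prob : ∀ α, IsProbabilityMeasure (mα α)
  concentrated : ∀ᵐ α ∂q, mα α (Xα α)ᶜ = 0
  measurable : ∀ B : Set X, MeasurableSet B → AEMeasurable (fun α => mα α B) q
  disint : ∀ B : Set X, MeasurableSet B → m.restrict (transportSet u) B = ∫⁻ α, mα α B ∂q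
  ray : ∀ᵐ α ∂q, IsTransportRay u (Xα α)
  support : ∀ᵐ α ∂q, (mα α).support = Xα α

/-! ### The conditions `CD¹_u`, `MCP¹_u`, `CD¹_Lip`, `CD¹` and `MCP¹` -/

/-- The restriction of a measure to the subspace `S`, as a measure on the type `S`. -/
abbrev onSubspace {X : Type u} [MeasurableSpace X] (m : Measure X) (S : Set X) : Measure S :=
  m.comap Subtype.val

/-- `CD¹_u(K,N)` for a space of full support and a `1`-Lipschitz function `u`: almost every
`(X_α, d, 𝔪_α)` satisfies `CD(K,N)`. -/
def CD1u {X : Type u} [MetricSpace X] [MeasurableSpace X] (K N : ℝ) (m : Measure X)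
    (u : X → ℝ) : Prop :=
  ∃ (Q : Type u) (_ : MeasurableSpace Q) (q : Measure Q) (Xα : Q → Set X)
    (mα : Q → Measure X), IsRayDisintegration m u q Xα mα ∧
      ∀ᵐ α ∂q, CD K N (onSubspace (mα α) (Xα α))

/-- `MCP¹_u(K,N)` for a space of full support and `u = d(·, o)`: almost every
`(X_α, d, 𝔪_α)` satisfies `MCP(K,N)` with respect to `o ∈ X_α`. -/
def MCP1u {X : Type u} [MetricSpace X] [MeasurableSpace X] (K N : ℝ) (m : Measure X)
    (o : X) : Prop :=
  ∃ (Q : Type u) (_ : MeasurableSpace Q) (q : Measure Q) (Xα : Q → Set X)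
    (mα : Q → Measure X), IsRayDisintegration m (fun x => dist x o) q Xα mα ∧
      ∀ᵐ α ∂q, ∃ ho : o ∈ Xα α, MCPAt K N (onSubspace (mα α) (Xα α)) ⟨o, ho⟩

/-- The signed distance function `d_f(x) = sgn(f x) dist(x, {f = 0})`. -/
def signedDist {X : Type u} [MetricSpace X] (f : X → ℝ) (x : X) : ℝ :=
  Real.sign (f x) * Metric.infDist x {y | f y = 0}

/-- `CD¹_Lip(K,N)`: the space `(supp 𝔪, d, 𝔪)` satisfies `CD¹_u(K,N)` for all `1`-Lipschitz `u`. -/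
def CD1Lip {X : Type u} [MetricSpace X] [MeasurableSpace X] (K N : ℝ) (m : Measure X) : Prop :=
  ∀ u : m.support → ℝ, LipschitzWith 1 u → CD1u K N (onSubspace m m.support) u

/-- `CD¹(K,N)`: the space `(supp 𝔪, d, 𝔪)` satisfies `CD¹_{d_f}(K,N)` for all continuous `f` with
`{f = 0} ≠ ∅` whose signed distance function `d_f` is `1`-Lipschitz. -/
def CD1 {X : Type u} [MetricSpace X] [MeasurableSpace X] (K N : ℝ) (m : Measure X) : Prop :=
  ∀ f : m.support → ℝ, Continuous f → (∃ x, f x = 0) → LipschitzWith 1 (signedDist f) →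
    CD1u K N (onSubspace m m.support) (signedDist f)

/-- `MCP¹(K,N)`: the space `(supp 𝔪, d, 𝔪)` satisfies `MCP¹_u(K,N)` for all `u = d(·, o)` with
`o ∈ supp 𝔪`. -/
def MCP1 {X : Type u} [MetricSpace X] [MeasurableSpace X] (K N : ℝ) (m : Measure X) : Prop :=
  ∀ o : m.support, MCP1u K N (onSubspace m m.support) o

end

end MMS

/-!
# `CD¹`, `MCP¹` and `MCP_ε`

**From `MCP¹` to `MCP_ε`.** Fix `o` and write `𝔪 = ∫ 𝔪_α q(dα)` along the rays of `d(·, o)`. Almost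
every ray issues from `o`, so a point `x` of it is joined to `o` by exactly one geodesic inside the
ray, and `MCP(K,N)` on the ray says that moving each point along this geodesic up to time `t` takes
`τ ^ N 𝔪_α` below `𝔪_α` (`isContractiveRay_of_mcpAt`). Rays may overlap, so the geodesic is chosen
as a function of the pair `(α, x)`; it depends measurably on it because a ray is the support of
`𝔪_α` and its points can be read off from the masses `𝔪_α` gives to small sets
(`measurable_rayApprox`, `dist_rayApprox_lt`). Integrating over `α` yields one measure `P` on
geodesics, with initial law `𝔪` and all geodesics ending at `o`, for which the image at time `t` of
`τ ^ N P` is below `𝔪`: an `IsContractionPlan`.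

Given `μ₀ = ρ₀ 𝔪`, the plan for `MCP_ε` is `P` with density `ρ₀(γ₀)`. It is optimal as its target is
a Dirac mass (`mem_optGeo_dirac`). With `p = 1 - 1/N`, the entropy bound comes from the pointwise
inequality `τ ρ₀ ^ p ≤ p l ^ (p - 1) ρ₀ + (1 - p) l ^ p τ ^ N` (`mul_rpow_le_linearization`), in
which `l` is the density of the image measure at the endpoint `γ_t`: after integration the first
term gives at most `p` times the entropy, and by the contraction bound so does the second with
`1 - p` (`lintegral_le_renyi`). Overlapping rays and non-injective evaluation maps are harmless for
this argument.

**From `CD¹` to `MCP¹`.** The function `d(·, o)` is `1`-Lipschitz and is its own signed distance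
function, so it remains to derive `MCP(K,N)` with respect to `o` from `CD(K,N)` on a ray issuing
from `o`. Transporting a compact set `E` to the ball `B(o, ε)` and letting `ε → 0` gives a
Brunn–Minkowski inequality for `E` and its contraction (`IsRayFrom.mul_measure_rpow_le`); inner
regularity and simple functions turn it into the density bound (`IsRayFrom.map_withDensity_le`).
-/

namespace MMS

open Set ProbabilityTheory Filter
open scoped Topology

/-! ### Geodesics and plans ending at a point -/

section Geodesics

variable {X : Type u} [MetricSpace X]

lemma Geo.continuous_eval (t : unitInterval) : Continuous (Geo.eval (X := X) t) :=
  (continuous_eval_const t).comp continuous_subtype_val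

lemma Geo.dist_eval (γ : Geo X) (s t : unitInterval) :
    dist (γ.eval s) (γ.eval t) = |(s : ℝ) - t| * dist (γ.eval 0) (γ.eval 1) :=
  γ.2 s t

lemma Geo.edist_eval (γ : Geo X) (s t : unitInterval) :
    edist (γ.eval s) (γ.eval t) =
      ENNReal.ofReal |(s : ℝ) - t| * edist (γ.eval 0) (γ.eval 1) := by
  rw [edist_dist, edist_dist, γ.dist_eval, ENNReal.ofReal_mul (abs_nonneg _)]

lemma Geo.dist_eval_one (γ : Geo X) (t : unitInterval) :
    dist (γ.eval t) (γ.eval 1) = (1 - t) * dist (γ.eval 0) (γ.eval 1) := by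
  rw [γ.dist_eval, Icc.coe_one, abs_sub_comm, abs_of_nonneg (sub_nonneg.2 t.2.2)]

lemma Geo.measurable_eval [MeasurableSpace X] [BorelSpace X] (t : unitInterval) :
    Measurable (Geo.eval (X := X) t) :=
  (Geo.continuous_eval t).measurable

/-- The geodesic given by a map with the defining property of geodesics; continuity is automatic,
as such a map is Lipschitz. -/
def Geo.ofDistEq (f : unitInterval → X)
    (hf : ∀ s t, dist (f s) (f t) = |(s : ℝ) - t| * dist (f 0) (f 1)) : Geo X :=
  ⟨⟨f, by
    have : LipschitzWith (dist (f 0) (f 1)).toNNReal f := by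
      refine LipschitzWith.of_dist_le_mul fun s t => ?_
      rw [hf, Real.coe_toNNReal _ dist_nonneg, mul_comm]
      rfl
    exact this.continuous⟩, hf⟩

instance [SecondCountableTopology X] : SecondCountableTopology (Geo X) :=
  TopologicalSpace.Subtype.secondCountableTopology _

lemma isP2_iff [MeasurableSpace X] [BorelSpace X] {μ : Measure X} [IsProbabilityMeasure μ]
    (o : X) : IsP2 μ ↔ ∫⁻ x, edist x o ^ 2 ∂μ < ∞ := by
  refine ⟨fun ⟨_, x₀, h⟩ => ?_, fun h => ⟨inferInstance, o, h⟩⟩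
  calc ∫⁻ x, edist x o ^ 2 ∂μ ≤ ∫⁻ x, (2 * edist x x₀ ^ 2 + 2 * edist x₀ o ^ 2) ∂μ := by
        refine lintegral_mono fun x => ?_
        have h1 : edist x o ≤ edist x x₀ + edist x₀ o := edist_triangle _ _ _
        refine (pow_le_pow_left' h1 2).trans ?_
        have h2 := ENNReal.rpow_add_le_mul_rpow_add_rpow (edist x x₀) (edist x₀ o)
          (p := 2) (by norm_num)
        have h3 : ((2 : ℝ≥0∞) ^ ((2 : ℝ) - 1)) = 2 := by norm_num
        rw [h3] at h2
        simpa [mul_add] using h2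
    _ = 2 * ∫⁻ x, edist x x₀ ^ 2 ∂μ + 2 * edist x₀ o ^ 2 := by
        rw [lintegral_add_right _ measurable_const, lintegral_const_mul' _ _ (by simp)]
        simp
    _ < ∞ := by
        refine ENNReal.add_lt_top.2 ⟨ENNReal.mul_lt_top (by simp) h, ?_⟩
        exact ENNReal.mul_lt_top (by simp) (ENNReal.pow_lt_top (edist_lt_top _ _))

/-- A probability measure on geodesics that all end at `o` is an optimal dynamical plan: the only
coupling with `δ_o` is the product, and the triangle inequality for the `L²` norms of the distance
from `o` bounds every other coupling from below. -/
lemma mem_optGeo_dirac [SecondCountableTopology X] [MeasurableSpace X] [BorelSpace X]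
    {o : X} {ν : Measure (Geo X)} [IsProbabilityMeasure ν] (h1 : ∀ᵐ γ ∂ν, γ.eval 1 = o)
    (h2 : IsP2 (ν.map (Geo.eval 0))) :
    ν ∈ OptGeo (ν.map (Geo.eval 0)) (Measure.dirac o) := by
  have hp (t : unitInterval) : IsProbabilityMeasure (ν.map (Geo.eval t)) :=
    Measure.isProbabilityMeasure_map (Geo.measurable_eval t).aemeasurable
  set C := ∫⁻ x, edist x o ^ 2 ∂(ν.map (Geo.eval 0)) with hC
  have hCfin : C < ∞ := (isP2_iff o).1 h2
  have hC' : ∫⁻ γ : Geo X, edist (γ.eval 0) (γ.eval 1) ^ 2 ∂ν = C := by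
    rw [hC, lintegral_map (by fun_prop) (Geo.measurable_eval 0)]
    refine lintegral_congr_ae ?_
    filter_upwards [h1] with γ hγ
    rw [hγ]
  have hst (s t : unitInterval) : ∫⁻ γ : Geo X, edist (γ.eval s) (γ.eval t) ^ 2 ∂ν =
      ENNReal.ofReal |(s : ℝ) - t| ^ 2 * C := by
    rw [← hC', ← lintegral_const_mul' _ _ (by simp)]
    refine lintegral_congr fun γ => ?_
    rw [γ.edist_eval, mul_pow]
  have hmom (t : unitInterval) : ∫⁻ x, edist x o ^ 2 ∂(ν.map (Geo.eval t)) =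
      ENNReal.ofReal (1 - t) ^ 2 * C := by
    rw [lintegral_map (by fun_prop) (Geo.measurable_eval t)]
    have := hst t 1
    rw [Icc.coe_one, abs_sub_comm, abs_of_nonneg (sub_nonneg.2 t.2.2)] at this
    rw [← this]
    refine lintegral_congr_ae ?_
    filter_upwards [h1] with γ hγ
    rw [hγ]
  have hsqrt (a b : ℝ≥0∞) : (a ^ 2 * b) ^ (1 / 2 : ℝ) = a * b ^ (1 / 2 : ℝ) := by
    rw [ENNReal.mul_rpow_of_nonneg _ _ (by norm_num), ← ENNReal.rpow_natCast,
      ← ENNReal.rpow_mul]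
    norm_num
  -- the lower bound on an arbitrary coupling
  have hlow (s t : unitInterval) (hle : s ≤ t) (π : Measure (X × X))
      (hπs : π.map Prod.fst = ν.map (Geo.eval s) ∧ π.map Prod.snd = ν.map (Geo.eval t) ∨
        π.map Prod.snd = ν.map (Geo.eval s) ∧ π.map Prod.fst = ν.map (Geo.eval t)) :
      ENNReal.ofReal (t - s) * C ^ (1 / 2 : ℝ) ≤
        (∫⁻ z, edist z.1 z.2 ^ 2 ∂π) ^ (1 / 2 : ℝ) := by
    have hle' : (s : ℝ) ≤ t := hle
    have key : ∀ f g : X × X → X, Measurable f → Measurable g →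
        (∀ z, edist (f z) (g z) = edist z.1 z.2) →
        π.map f = ν.map (Geo.eval s) → π.map g = ν.map (Geo.eval t) →
        ENNReal.ofReal (1 - s) * C ^ (1 / 2 : ℝ) ≤
          (∫⁻ z, edist z.1 z.2 ^ 2 ∂π) ^ (1 / 2 : ℝ) +
            ENNReal.ofReal (1 - t) * C ^ (1 / 2 : ℝ) := by
      intro f g hf hg hfg hπf hπg
      have e1 : ∫⁻ z, edist (f z) o ^ 2 ∂π = ENNReal.ofReal (1 - s) ^ 2 * C := by
        rw [← hmom s, ← hπf, lintegral_map (by fun_prop) hf]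
      have e2 : ∫⁻ z, edist (g z) o ^ 2 ∂π = ENNReal.ofReal (1 - t) ^ 2 * C := by
        rw [← hmom t, ← hπg, lintegral_map (by fun_prop) hg]
      rw [← hsqrt, ← hsqrt, ← e1, ← e2]
      have mink := ENNReal.lintegral_Lp_add_le (μ := π) (p := 2)
        (f := fun z => edist z.1 z.2) (g := fun z => edist (g z) o)
        (by fun_prop) (by fun_prop) (by norm_num)
      simp only [Pi.add_apply, ENNReal.rpow_ofNat] at mink
      refine le_trans ?_ mink
      gcongr with z
      rw [← hfg]
      exact edist_triangle _ _ _
    have key' : ENNReal.ofReal (1 - s) * C ^ (1 / 2 : ℝ) ≤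
          (∫⁻ z, edist z.1 z.2 ^ 2 ∂π) ^ (1 / 2 : ℝ) +
            ENNReal.ofReal (1 - t) * C ^ (1 / 2 : ℝ) := by
      rcases hπs with ⟨ha, hb⟩ | ⟨ha, hb⟩
      · exact key _ _ measurable_fst measurable_snd (fun _ => rfl) ha hb
      · exact key _ _ measurable_snd measurable_fst (fun _ => edist_comm _ _) ha hb
    have hsplit : ENNReal.ofReal (1 - s) =
        ENNReal.ofReal (t - s) + ENNReal.ofReal (1 - t) := by
      rw [← ENNReal.ofReal_add (sub_nonneg.2 hle') (sub_nonneg.2 t.2.2)]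
      ring_nf
    rw [hsplit, add_mul] at key'
    refine (ENNReal.add_le_add_iff_right ?_).1 key'
    exact ENNReal.mul_ne_top (by simp) (ENNReal.rpow_ne_top_of_nonneg (by norm_num) hCfin.ne)
  have hW (s t : unitInterval) : W2 (ν.map (Geo.eval s)) (ν.map (Geo.eval t)) =
      ENNReal.ofReal |(s : ℝ) - t| * C ^ (1 / 2 : ℝ) := by
    refine le_antisymm ?_ ?_
    · rw [← hsqrt, ← hst]
      refine ENNReal.rpow_le_rpow ?_ (by norm_num)
      have hm : Measurable fun γ : Geo X => (γ.eval s, γ.eval t) :=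
        (Geo.measurable_eval s).prodMk (Geo.measurable_eval t)
      refine (iInf_le _ ⟨ν.map fun γ => (γ.eval s, γ.eval t),
        Measure.map_map measurable_fst hm, Measure.map_map measurable_snd hm⟩).trans_eq ?_
      exact lintegral_map (f := fun z : X × X => edist z.1 z.2 ^ 2) (by fun_prop) hm
    · unfold W2
      -- the infimum is moved outside the monotone power map
      have hinf : ∀ c : ℝ≥0∞, ∀ (ι : Type u) (f : ι → ℝ≥0∞),
          (∀ i, c ≤ f i ^ (1 / 2 : ℝ)) → c ≤ (⨅ i, f i) ^ (1 / 2 : ℝ) := by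
        intro c ι f h
        have hc : c = (c ^ 2) ^ (1 / 2 : ℝ) := by simpa using (hsqrt c 1).symm
        rw [hc]
        refine ENNReal.rpow_le_rpow (le_iInf fun i => ?_) (by norm_num)
        have h3 := pow_le_pow_left' (h i) 2
        rwa [← ENNReal.rpow_natCast (f i ^ (1 / 2 : ℝ)), ← ENNReal.rpow_mul,
          show (1 / 2 : ℝ) * ((2 : ℕ) : ℝ) = 1 by norm_num, ENNReal.rpow_one] at h3
      refine hinf _ _ _ fun π => ?_
      rcases le_total s t with h | h
      · have h' : (s : ℝ) ≤ t := h
        rw [abs_sub_comm, abs_of_nonneg (sub_nonneg.2 h')]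
        exact hlow s t h _ (Or.inl ⟨π.2.1, π.2.2⟩)
      · have h' : (t : ℝ) ≤ s := h
        rw [abs_of_nonneg (sub_nonneg.2 h')]
        exact hlow t s h _ (Or.inr ⟨π.2.2, π.2.1⟩)
  refine ⟨inferInstance, fun t => ?_, fun s t => ?_, rfl, ?_⟩
  · refine (isP2_iff o).2 ?_
    rw [hmom]
    exact ENNReal.mul_lt_top (by simp) hCfin
  · rw [hW, hW]
    simp
  · rw [Measure.map_congr (g := fun _ => o) h1, Measure.map_const]
    simp

end Geodesics

/-! ### Distortion coefficients -/

lemma measurable_sigmaCoeff (K n t : ℝ) : Measurable (sigmaCoeff K n t) := by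
  unfold sigmaCoeff
  refine Measurable.ite ?_ measurable_const ?_
  · exact (measurableSet_eq_fun measurable_id measurable_const).union (MeasurableSet.const _)
  · refine Measurable.ite (MeasurableSet.const _) ?_ (by fun_prop)
    exact Measurable.ite (measurableSet_lt measurable_id measurable_const) (by fun_prop)
      measurable_const

lemma measurable_tauCoeff (K N t : ℝ) : Measurable (tauCoeff K N t) :=
  ((measurable_sigmaCoeff K (N - 1) t).pow_const _).const_mul _

lemma tauCoeff_zero_right {K N t : ℝ} (hN : 1 < N) :
    tauCoeff K N t 0 = ENNReal.ofReal t := by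
  rw [tauCoeff, sigmaCoeff, if_pos (Or.inl rfl), ← ENNReal.rpow_add_of_nonneg _ _ (by positivity)]
  · simp
  · have : 1 / N ≤ 1 := by rw [div_le_one (by linarith)]; exact hN.le
    linarith

lemma tauCoeff_zero_left {K N : ℝ} (hN : 1 < N) (θ : ℝ) : tauCoeff K N 0 θ = 0 := by
  have : 0 < 1 / N := by positivity
  rw [tauCoeff, ENNReal.ofReal_zero, ENNReal.zero_rpow_of_pos this, zero_mul]

/-! ### A lower bound for the Rényi entropy of a contracted measure -/

/-- Weighted arithmetic-geometric mean inequality, in the form in which the free parameter `l`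
linearises the concave function `r ↦ r ^ (1 - 1 / N)`. -/
lemma mul_rpow_le_linearization {N : ℝ} (hN : 1 < N) (τ r l : ℝ≥0∞) :
    τ * r ^ (1 - 1 / N) ≤ ENNReal.ofReal (1 - 1 / N) * (l ^ (1 - 1 / N - 1) * r) +
      ENNReal.ofReal (1 / N) * (l ^ (1 - 1 / N) * τ ^ N) := by
  have hN0 : 0 < N := by linarith
  have hq : 0 < 1 / N := by positivity
  have hp : 0 < 1 - 1 / N := by
    rw [sub_pos, div_lt_one hN0]; exact hN
  set p := 1 - 1 / N with hpdef
  rcases eq_or_ne l 0 with rfl | hl0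
  · rcases eq_or_ne r 0 with rfl | hr
    · simp [ENNReal.zero_rpow_of_pos hp]
    · rw [ENNReal.zero_rpow_of_neg (by linarith), ENNReal.top_mul hr,
        ENNReal.mul_top (by simpa using hp)]
      simp
  rcases eq_or_ne l ∞ with rfl | hlt
  · rcases eq_or_ne τ 0 with rfl | hτ
    · simp
    · rw [ENNReal.top_rpow_of_pos hp, ENNReal.top_mul (by simp [hτ, hN0.le]),
        ENNReal.mul_top (by simpa using hN0)]
      simp
  have hconj : (1 / p).HolderConjugate N := by
    rw [Real.holderConjugate_iff]
    refine ⟨by rw [lt_div_iff₀ hp]; linarith, ?_⟩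
    rw [one_div, inv_inv, hpdef]; field_simp; ring
  have hy := ENNReal.young_inequality ((l ^ (p - 1) * r) ^ p) ((l ^ p) ^ (1 / N) * τ) hconj
  have e1 : (l ^ (p - 1) * r) ^ p * ((l ^ p) ^ (1 / N) * τ) = τ * r ^ p := by
    rw [ENNReal.mul_rpow_of_nonneg _ _ hp.le, ← ENNReal.rpow_mul, ← ENNReal.rpow_mul,
      show l ^ ((p - 1) * p) * r ^ p * (l ^ (p * (1 / N)) * τ) =
        (l ^ ((p - 1) * p) * l ^ (p * (1 / N))) * (τ * r ^ p) by ring,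
      ← ENNReal.rpow_add _ _ hl0 hlt, show (p - 1) * p + p * (1 / N) = 0 by rw [hpdef]; ring]
    simp
  have e2 : ((l ^ (p - 1) * r) ^ p) ^ (1 / p) / ENNReal.ofReal (1 / p) =
      ENNReal.ofReal p * (l ^ (p - 1) * r) := by
    rw [← ENNReal.rpow_mul, mul_one_div_cancel hp.ne', ENNReal.rpow_one, one_div,
      ENNReal.ofReal_inv_of_pos hp, div_eq_mul_inv, inv_inv, mul_comm]
  have e3 : ((l ^ p) ^ (1 / N) * τ) ^ N / ENNReal.ofReal N =
      ENNReal.ofReal (1 / N) * (l ^ p * τ ^ N) := by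
    rw [ENNReal.mul_rpow_of_nonneg _ _ hN0.le, ← ENNReal.rpow_mul (l ^ p),
      one_div_mul_cancel hN0.ne', ENNReal.rpow_one, one_div N,
      ENNReal.ofReal_inv_of_pos hN0, div_eq_mul_inv, mul_comm]
  rwa [e1, e2, e3] at hy

/-- If `T` contracts `P`, weighted by `τ ^ N`, below `m`, then the entropy of the image of `r P`
is at least `∫ τ r ^ (1 - 1 / N)`. The map `T` need not be injective: the integrand is linearised
around the density of the image measure. -/
lemma lintegral_le_renyi {Z X : Type*} [MeasurableSpace Z] [MeasurableSpace X] {N : ℝ}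
    (hN : 1 < N) {P : Measure Z} {m : Measure X} [SigmaFinite m] {T : Z → X} (hT : Measurable T)
    {τ r : Z → ℝ≥0∞} (hτ : Measurable τ) (hr : Measurable r)
    [IsFiniteMeasure ((P.withDensity r).map T)]
    (h : (P.withDensity fun z => τ z ^ N).map T ≤ m) :
    ∫⁻ z, τ z * r z ^ (1 - 1 / N) ∂P ≤
      ∫⁻ x, ((P.withDensity r).map T).rnDeriv m x ^ (1 - 1 / N) ∂m := by
  have hN0 : 0 < N := by linarith
  have hq : 0 < 1 / N := by positivity
  have hp : 0 < 1 - 1 / N := by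
    rw [sub_pos, div_lt_one hN0]; exact hN
  set p := 1 - 1 / N with hpdef
  set μ := (P.withDensity r).map T with hμ
  obtain ⟨s, hs, hs1, hs2⟩ := Measure.mutuallySingular_singularPart μ m
  have hrn := Measure.measurable_rnDeriv μ m
  classical
  -- the density of `μ`, set to `∞` on a null set that carries the singular part of `μ`
  set l : X → ℝ≥0∞ := s.piecewise (μ.rnDeriv m) (fun _ => ∞) with hl
  have hlm : Measurable l := hrn.piecewise hs measurable_const
  have hA : ∫⁻ x, l x ^ p ∂m = ∫⁻ x, μ.rnDeriv m x ^ p ∂m := by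
    refine lintegral_congr_ae ?_
    have : ∀ᵐ x ∂m, x ∈ s := hs2
    filter_upwards [this] with x hx
    rw [hl, piecewise_eq_of_mem _ _ _ hx]
  have hrestr : μ.restrict s = (m.withDensity (μ.rnDeriv m)).restrict s := by
    conv_lhs => rw [Measure.haveLebesgueDecomposition_add μ m]
    rw [Measure.restrict_add, Measure.restrict_eq_zero.2 hs1, zero_add]
  have hB : ∫⁻ x, l x ^ (p - 1) ∂μ ≤ ∫⁻ x, μ.rnDeriv m x ^ p ∂m := by
    have h0 : ∫⁻ x in sᶜ, l x ^ (p - 1) ∂μ = 0 := by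
      rw [setLIntegral_congr_fun hs.compl (g := fun _ => 0)]
      · simp
      · intro x hx
        simp only [hl, piecewise_eq_of_notMem _ _ _ hx]
        exact ENNReal.top_rpow_of_neg (by linarith)
    have h1 : ∫⁻ x in s, l x ^ (p - 1) ∂μ = ∫⁻ x in s, μ.rnDeriv m x ^ (p - 1) ∂μ :=
      setLIntegral_congr_fun hs fun x hx => by simp only [hl, piecewise_eq_of_mem _ _ _ hx]
    rw [← lintegral_add_compl _ hs, h0, add_zero, h1, hrestr,
      setLIntegral_withDensity_eq_setLIntegral_mul _ hrn (hrn.pow_const _) hs]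
    refine (setLIntegral_le_lintegral _ _).trans (lintegral_mono fun x => ?_)
    simp only [Pi.mul_apply]
    rcases eq_or_ne (μ.rnDeriv m x) 0 with h0 | h0
    · simp [h0]
    rcases eq_or_ne (μ.rnDeriv m x) ∞ with ht | ht
    · rw [ht, ENNReal.top_rpow_of_neg (by linarith)]; simp
    · conv_lhs => rw [← ENNReal.rpow_one (μ.rnDeriv m x), ← ENNReal.rpow_mul, one_mul,
        ← ENNReal.rpow_add _ _ h0 ht]
      rw [add_sub_cancel]
  have hC : ∫⁻ z, l (T z) ^ (p - 1) * r z ∂P = ∫⁻ x, l x ^ (p - 1) ∂μ := by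
    have hlT : Measurable fun z => l (T z) ^ (p - 1) := (hlm.comp hT).pow_const _
    rw [hμ, lintegral_map (hlm.pow_const _) hT, lintegral_withDensity_eq_lintegral_mul _ hr hlT]
    simp only [Pi.mul_apply, mul_comm]
  have hD : ∫⁻ z, l (T z) ^ p * τ z ^ N ∂P ≤ ∫⁻ x, l x ^ p ∂m := by
    refine le_trans (le_of_eq ?_) (lintegral_mono' h le_rfl)
    have hlT : Measurable fun z => l (T z) ^ p := (hlm.comp hT).pow_const _
    rw [lintegral_map (hlm.pow_const _) hT, lintegral_withDensity_eq_lintegral_mul _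
      (hτ.pow_const _) hlT]
    simp only [Pi.mul_apply, mul_comm]
  calc ∫⁻ z, τ z * r z ^ p ∂P
      ≤ ∫⁻ z, (ENNReal.ofReal p * (l (T z) ^ (p - 1) * r z) +
          ENNReal.ofReal (1 / N) * (l (T z) ^ p * τ z ^ N)) ∂P :=
        lintegral_mono fun z => mul_rpow_le_linearization hN _ _ _
    _ = ENNReal.ofReal p * ∫⁻ z, l (T z) ^ (p - 1) * r z ∂P +
          ENNReal.ofReal (1 / N) * ∫⁻ z, l (T z) ^ p * τ z ^ N ∂P := by
        have hm1 : Measurable fun z => l (T z) ^ (p - 1) * r z :=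
          ((hlm.pow_const _).comp hT).mul hr
        rw [lintegral_add_left (hm1.const_mul _), lintegral_const_mul' _ _ (by simp),
          lintegral_const_mul' _ _ (by simp)]
    _ ≤ ENNReal.ofReal p * ∫⁻ x, μ.rnDeriv m x ^ p ∂m +
          ENNReal.ofReal (1 / N) * ∫⁻ x, μ.rnDeriv m x ^ p ∂m := by
        rw [hC]
        gcongr
        exact hD.trans_eq hA
    _ = ∫⁻ x, μ.rnDeriv m x ^ p ∂m := by
        rw [← add_mul, ← ENNReal.ofReal_add hp.le hq.le, hpdef]
        simp

/-- A contraction plan for `m` towards `o`, up to the set `A`: a measure on geodesics that start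
with law `m` and end at `o`, and along which the part of `m` that starts in `A`, weighted by
`τ ^ N`, stays below `m`. -/
structure IsContractionPlan {X : Type u} [MetricSpace X] [MeasurableSpace X] (K N : ℝ)
    (m : Measure X) (o : X) (A : Set X) (P : Measure (Geo X)) : Prop where
  map_eval_zero : P.map (Geo.eval 0) = m
  ae_eval_one : ∀ᵐ γ ∂P, γ.eval 1 = o
  map_eval_le : ∀ t : unitInterval,
    (P.withDensity fun γ =>
      A.indicator (fun x => tauCoeff K N (1 - t) (dist x o) ^ N) (γ.eval 0)).map (Geo.eval t) ≤ m

section Entropy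

variable {X : Type u} [MetricSpace X] [SecondCountableTopology X] [MeasurableSpace X]
  [BorelSpace X] {K N : ℝ} {m : Measure X} {o : X} {A : Set X} {P : Measure (Geo X)}

lemma map_withDensity_comp {Z Y : Type*} [MeasurableSpace Z] [MeasurableSpace Y] (P : Measure Z)
    {T : Z → Y} (hT : Measurable T) {f : Y → ℝ≥0∞} (hf : Measurable f) :
    (P.withDensity fun z => f (T z)).map T = (P.map T).withDensity f := by
  ext s hs
  rw [Measure.map_apply hT hs, withDensity_apply _ (hT hs), withDensity_apply _ hs,
    setLIntegral_map hs hf hT]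

/-- A contraction plan yields the plan required by `MCP_ε`: reweight it by the density of `μ₀` at
the starting point. -/
lemma IsContractionPlan.exists_optGeo [IsProbabilityMeasure m] (hP : IsContractionPlan K N m o A P)
    (hN : 1 < N) (hA : MeasurableSet A) {μ₀ : Measure X} (hμ₀ : IsP2ac m μ₀) (hμA : μ₀ Aᶜ = 0) :
    ∃ ν ∈ OptGeo μ₀ (Measure.dirac o), ν ≪ P ∧ ∀ t : unitInterval,
      ∫⁻ x, tauCoeff K N (1 - t) (dist x o) * μ₀.rnDeriv m x ^ (1 - 1 / N) ∂m ≤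
        renyi N m (ν.map (Geo.eval t)) := by
  have := hμ₀.1.1
  have hN0 : 0 < N := by linarith
  have hp : 0 < 1 - 1 / N := by
    rw [sub_pos, div_lt_one hN0]; exact hN
  set ρ := μ₀.rnDeriv m with hρ
  have hρm : Measurable ρ := Measure.measurable_rnDeriv _ _
  have hμρ : m.withDensity ρ = μ₀ := Measure.withDensity_rnDeriv_eq _ _ hμ₀.2
  set ν := P.withDensity fun γ => ρ (γ.eval 0) with hν
  have hν0 : ν.map (Geo.eval 0) = μ₀ := by
    rw [hν, map_withDensity_comp P (Geo.measurable_eval 0) hρm, hP.map_eval_zero, hμρ]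
  have hνprob : IsProbabilityMeasure ν := by
    refine ⟨?_⟩
    rw [← measure_univ (μ := μ₀), ← hν0, Measure.map_apply (Geo.measurable_eval 0) .univ]
    rfl
  have hac : ν ≪ P := withDensity_absolutelyContinuous _ _
  refine ⟨ν, ?_, hac, fun t => ?_⟩
  · have := mem_optGeo_dirac (hac.ae_le hP.ae_eval_one) (by rw [hν0]; exact hμ₀.1)
    rwa [hν0] at this
  have : IsFiniteMeasure (ν.map (Geo.eval t)) := by infer_instance
  have hd : Measurable fun x : X => dist x o := by fun_prop
  have hτ : Measurable fun x => A.indicator (fun x => tauCoeff K N (1 - t) (dist x o)) x :=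
    ((measurable_tauCoeff K N (1 - t)).comp hd).indicator hA
  have hρA : ∀ᵐ x ∂m, x ∉ A → ρ x = 0 := by
    have h0 : ∫⁻ x in Aᶜ, ρ x ∂m = 0 := by
      rw [← withDensity_apply _ hA.compl, hμρ, hμA]
    exact (ae_restrict_iff' hA.compl).1 ((lintegral_eq_zero_iff hρm).1 h0)
  calc ∫⁻ x, tauCoeff K N (1 - t) (dist x o) * ρ x ^ (1 - 1 / N) ∂m
      = ∫⁻ x, A.indicator (fun x => tauCoeff K N (1 - t) (dist x o)) x *
          ρ x ^ (1 - 1 / N) ∂m := by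
        refine lintegral_congr_ae ?_
        filter_upwards [hρA] with x hx
        by_cases hxA : x ∈ A
        · rw [indicator_of_mem hxA]
        · rw [hx hxA, ENNReal.zero_rpow_of_pos hp, mul_zero, mul_zero]
    _ = ∫⁻ γ, A.indicator (fun x => tauCoeff K N (1 - t) (dist x o)) (γ.eval 0) *
          ρ (γ.eval 0) ^ (1 - 1 / N) ∂P := by
        have hf : Measurable fun x =>
            A.indicator (fun x => tauCoeff K N (1 - t) (dist x o)) x * ρ x ^ (1 - 1 / N) :=
          hτ.mul (hρm.pow_const _)
        rw [← lintegral_map hf (Geo.measurable_eval 0), hP.map_eval_zero]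
    _ ≤ renyi N m (ν.map (Geo.eval t)) := by
        refine lintegral_le_renyi hN (Geo.measurable_eval t) (hτ.comp (Geo.measurable_eval 0))
          (hρm.comp (Geo.measurable_eval 0)) ?_
        convert hP.map_eval_le t using 4 with γ
        simp only [indicator]
        split_ifs <;> simp [hN0]

end Entropy

/-! ### Rays issuing from a point -/

/-- `S` is a ray issuing from `o`: the function `d(·, o)` is an isometry of `S` onto an interval
that contains `0`. -/
structure IsRayFrom {X : Type u} [MetricSpace X] (o : X) (S : Set X) : Prop where
  dist_eq : ∀ x ∈ S, ∀ y ∈ S, dist x y = |dist x o - dist y o|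
  exists_dist_eq : ∀ x ∈ S, ∀ s ∈ Icc (0 : ℝ) 1, ∃ y ∈ S, dist y o = s * dist x o

section Rays

variable {X : Type u} [MetricSpace X] {o : X} {S : Set X}

lemma IsRayFrom.eq_of_dist_eq (h : IsRayFrom o S) {x y : X} (hx : x ∈ S) (hy : y ∈ S)
    (hxy : dist x o = dist y o) : x = y := by
  rw [← dist_eq_zero, h.dist_eq x hx y hy, hxy, sub_self, abs_zero]

lemma IsRayFrom.exists_geo (h : IsRayFrom o S) {x : X} (hx : x ∈ S) :
    ∃ γ : Geo X, γ.eval 0 = x ∧ γ.eval 1 = o ∧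
      ∀ t : unitInterval, γ.eval t ∈ S ∧ dist (γ.eval t) o = (1 - t) * dist x o := by
  have hex (t : unitInterval) : ∃ y ∈ S, dist y o = (1 - t) * dist x o :=
    h.exists_dist_eq x hx _ ⟨by linarith [t.2.2], by linarith [t.2.1]⟩
  choose f hfS hf using hex
  have h0 : f 0 = x := h.eq_of_dist_eq (hfS 0) hx (by rw [hf]; simp)
  have h1 : f 1 = o := by rw [← dist_eq_zero, hf]; simp
  refine ⟨Geo.ofDistEq f fun s t => ?_, h0, h1, fun t => ⟨hfS t, hf t⟩⟩
  rw [h0, h1, h.dist_eq _ (hfS s) _ (hfS t), hf, hf, ← sub_mul, abs_mul, abs_of_nonneg dist_nonneg,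
    abs_sub_comm]
  ring_nf

/-- A transport ray of `d(·, o)` issues from `o`: every point is comparable with `o`, so a maximal
chain contains `o`. -/
lemma IsTransportRay.mem_and_isRayFrom (h : IsTransportRay (fun x => dist x o) S) :
    o ∈ S ∧ IsRayFrom o S := by
  obtain ⟨⟨hc, hmax⟩, I, -, hI, -, ⟨e⟩⟩ := h
  have ho : o ∈ S := by
    have : IsChain (Gam fun x => dist x o) (insert o S) :=
      hc.insert fun b _ _ => Or.inr (by simp [Gam])
    rw [hmax this (subset_insert _ _)]
    exact mem_insert _ _
  refine ⟨ho, fun x hx y hy => ?_, fun x hx s hs => ?_⟩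
  · rcases eq_or_ne x y with rfl | hxy
    · simp
    rcases hc hx hy hxy with h | h
    · rw [show dist x o - dist y o = dist x y from h, abs_of_nonneg dist_nonneg]
    · rw [abs_sub_comm, show dist y o - dist x o = dist y x from h, abs_of_nonneg dist_nonneg,
        dist_comm]
  · have : PreconnectedSpace I := Subtype.preconnectedSpace hI.isPreconnected
    have hpre : IsPreconnected (range fun i : I => dist (e i : X) o) :=
      isPreconnected_range (by fun_prop)
    have h0 : (0 : ℝ) ∈ range fun i : I => dist (e i : X) o := ⟨e.symm ⟨o, ho⟩, by simp⟩
    have h1 : dist x o ∈ range fun i : I => dist (e i : X) o := ⟨e.symm ⟨x, hx⟩, by simp⟩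
    obtain ⟨i, hi⟩ := hpre.ordConnected.out h0 h1
      (show s * dist x o ∈ Icc 0 (dist x o) from
        ⟨mul_nonneg hs.1 dist_nonneg, mul_le_of_le_one_left dist_nonneg hs.2⟩)
    exact ⟨e i, (e i).2, hi⟩

end Rays

/-! ### Measurable selection of geodesics -/

section Selection

variable {X : Type u} [MetricSpace X]

lemma measurable_of_measurable_edist {Z M : Type*} [MeasurableSpace Z] [PseudoEMetricSpace M]
    [SecondCountableTopology M] [MeasurableSpace M] [BorelSpace M] {f : Z → M}
    (h : ∀ y, Measurable fun z => edist (f z) y) : Measurable f := by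
  refine measurable_of_isClosed fun s hs => ?_
  obtain ⟨c, hcs, hc, hsc⟩ :=
    (TopologicalSpace.IsSeparable.of_separableSpace s).exists_countable_dense_subset
  have hcl : closure c = s := (closure_minimal hcs hs).antisymm hsc
  have : f ⁻¹' s = {z | ⨅ y ∈ c, edist (f z) y = 0} := by
    ext z
    have := Metric.mem_closure_iff_infEDist_zero (x := f z) (s := c)
    rw [hcl] at this
    simpa [Metric.infEDist] using this
  rw [this]
  exact measurableSet_eq_fun (Measurable.biInf c hc fun y _ => h y) measurable_const

/-- The Borel sets of the space of geodesics are generated by the evaluations. -/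
lemma measurable_geo [SecondCountableTopology X] [MeasurableSpace X] [BorelSpace X]
    {Z : Type*} [MeasurableSpace Z] {f : Z → Geo X}
    (h : ∀ t, Measurable fun z => (f z).eval t) : Measurable f := by
  let _ : MeasurableSpace C(unitInterval, X) := borel _
  have : BorelSpace C(unitInterval, X) := ⟨rfl⟩
  have key : Measurable fun z => (f z).1 := by
    refine measurable_of_measurable_edist fun g => ?_
    have hsup (z : Z) : edist (f z).1 g =
        ⨆ n, edist ((f z).eval (TopologicalSpace.denseSeq unitInterval n))
          (g (TopologicalSpace.denseSeq unitInterval n)) := by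
      rw [ContinuousMap.edist_eq_iSup]
      refine le_antisymm (iSup_le fun t => ?_) (iSup_le fun n => le_iSup
        (fun t => edist ((f z).1 t) (g t)) _)
      refine (TopologicalSpace.denseRange_denseSeq unitInterval).induction_on
        (p := fun t => edist ((f z).1 t) (g t) ≤ _) t ?_ fun n => le_iSup
          (fun n => edist ((f z).eval (TopologicalSpace.denseSeq unitInterval n))
          (g (TopologicalSpace.denseSeq unitInterval n))) n
      exact isClosed_le (by fun_prop) continuous_const
    simp_rw [hsup]
    exact Measurable.iSup fun n => (h _).edist measurable_const
  have hb : borel (Geo X) = (borel C(unitInterval, X)).comap Subtype.val :=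
    borel_comap
  change @Measurable _ _ _ (borel (Geo X)) f
  rw [hb]
  exact measurable_comap_iff.2 key

/-- Some mass of `μ` is `δ`-close to the `n`-th point of a dense sequence, at a distance from `o`
that is `δ`-close to `s`. -/
def RayNear [SecondCountableTopology X] [MeasurableSpace X] [Nonempty X] (o : X) (μ : Measure X)
    (δ s : ℝ) (n : ℕ) : Prop :=
  0 < μ {y | |dist y o - s| < δ ∧ dist y (TopologicalSpace.denseSeq X n) < δ}

lemma exists_rayNear_or [SecondCountableTopology X] [MeasurableSpace X] [Nonempty X] (o : X)
    (μ : Measure X) (δ s : ℝ) : ∃ n, RayNear o μ δ s n ∨ ∀ k, ¬ RayNear o μ δ s k := by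
  by_cases h : ∃ n, RayNear o μ δ s n
  · exact h.imp fun _ => Or.inl
  · exact ⟨0, Or.inr (not_exists.1 h)⟩

open Classical in
/-- A measurable approximation of the point at distance `s` from `o` on a ray that is the support
of `μ`: the first point of a dense sequence near which `μ` has mass at distance about `s`. -/
noncomputable def rayApprox [SecondCountableTopology X] [MeasurableSpace X] [Nonempty X] (o : X)
    (μ : Measure X) (δ s : ℝ) : X :=
  TopologicalSpace.denseSeq X (Nat.find (exists_rayNear_or o μ δ s))

lemma dist_rayApprox_lt [SecondCountableTopology X] [MeasurableSpace X] [Nonempty X] {o : X}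
    {μ : Measure X} (h : IsRayFrom o μ.support) {x : X} (hx : x ∈ μ.support) {δ : ℝ}
    (hδ : 0 < δ) : dist (rayApprox o μ δ (dist x o)) x < 2 * δ := by
  classical
  have hex : ∃ n, RayNear o μ δ (dist x o) n := by
    obtain ⟨_, hn, n, rfl⟩ := Metric.dense_iff.1 (TopologicalSpace.denseRange_denseSeq X) x δ hδ
    have h1 : Continuous fun y => |dist y o - dist x o| := by fun_prop
    have h2 : Continuous fun y => dist y (TopologicalSpace.denseSeq X n) := by fun_prop
    exact ⟨n, (Measure.mem_support_iff_forall x).1 hx _ (((isOpen_lt h1 continuous_const).inter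
      (isOpen_lt h2 continuous_const)).mem_nhds
        ⟨by simpa using hδ, by simpa [dist_comm] using hn⟩)⟩
  have hspec := Nat.find_spec (exists_rayNear_or o μ δ (dist x o))
  rcases hspec with hpos | hno
  · obtain ⟨y, ⟨hy1, hy2⟩, hyS⟩ := Measure.nonempty_inter_support_of_pos hpos
    have h1 : dist y x < δ := by rw [h.dist_eq y hyS x hx]; exact hy1
    calc dist (rayApprox o μ δ (dist x o)) x
        ≤ dist (rayApprox o μ δ (dist x o)) y + dist y x := dist_triangle _ _ _
      _ < δ + δ := add_lt_add (by rw [dist_comm]; exact hy2) h1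
      _ = 2 * δ := by ring
  · obtain ⟨k, hk⟩ := hex
    exact absurd hk (hno k)

variable [SecondCountableTopology X] [MeasurableSpace X] [BorelSpace X]

lemma measurable_rayApprox [Nonempty X] {Q : Type*} [MeasurableSpace Q] (κ : Kernel Q X)
    [IsSFiniteKernel κ] (o : X) (δ : ℝ) :
    Measurable fun z : Q × ℝ => rayApprox o (κ z.1) δ z.2 := by
  classical
  have hm (n : ℕ) : Measurable fun z : Q × ℝ => κ z.1 {y | |dist y o - z.2| < δ ∧
      dist y (TopologicalSpace.denseSeq X n) < δ} := by
    have hs : MeasurableSet {w : (Q × ℝ) × X | |dist w.2 o - w.1.2| < δ ∧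
        dist w.2 (TopologicalSpace.denseSeq X n) < δ} := by
      have h1 : Measurable fun w : (Q × ℝ) × X => |dist w.2 o - w.1.2| := by fun_prop
      have h2 : Measurable fun w : (Q × ℝ) × X => dist w.2 (TopologicalSpace.denseSeq X n) := by
        fun_prop
      exact (measurableSet_lt h1 measurable_const).inter (measurableSet_lt h2 measurable_const)
    exact Kernel.measurable_kernel_prodMk_left (κ := κ.comap Prod.fst measurable_fst) hs
  have hpos (n : ℕ) : MeasurableSet {z : Q × ℝ | RayNear o (κ z.1) δ z.2 n} :=
    measurableSet_lt measurable_const (hm n)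
  refine (measurable_from_nat (f := TopologicalSpace.denseSeq X)).comp
    (measurable_find (fun z : Q × ℝ => exists_rayNear_or o (κ z.1) δ z.2) fun n => ?_)
  have hnone : {z : Q × ℝ | ∀ k, ¬ RayNear o (κ z.1) δ z.2 k} =
      ⋂ k, {z : Q × ℝ | RayNear o (κ z.1) δ z.2 k}ᶜ := by
    ext z
    rw [mem_iInter]
    rfl
  have hnone' : MeasurableSet {z : Q × ℝ | ∀ k, ¬ RayNear o (κ z.1) δ z.2 k} := by
    rw [hnone]
    exact MeasurableSet.iInter fun k => (hpos k).compl
  exact (hpos n).union hnone'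

lemma measurableSet_mem_support {Q : Type*} [MeasurableSpace Q] (κ : Kernel Q X)
    [IsSFiniteKernel κ] : MeasurableSet {z : Q × X | z.2 ∈ (κ z.1).support} := by
  have hm (n : ℕ) : Measurable fun z : Q × X => κ z.1 (Metric.ball z.2 (1 / (n + 1))) := by
    have hs : MeasurableSet {w : (Q × X) × X | dist w.2 w.1.2 < 1 / ((n : ℝ) + 1)} :=
      measurableSet_lt (by fun_prop) measurable_const
    exact Kernel.measurable_kernel_prodMk_left (κ := κ.comap Prod.fst measurable_fst) hs
  have : {z : Q × X | z.2 ∈ (κ z.1).support} =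
      ⋂ n : ℕ, {z : Q × X | 0 < κ z.1 (Metric.ball z.2 (1 / (n + 1)))} := by
    ext z
    simp [Metric.nhds_basis_ball_inv_nat_succ.mem_measureSupport]
  rw [this]
  exact MeasurableSet.iInter fun n => measurableSet_lt measurable_const (hm n)

end Selection

/-! ### Gluing the contractions of the rays -/

/-- The support of `μ` is a ray issuing from `o`, and the contraction of this ray towards `o`
satisfies the density bound of `MCP(K,N)` for the mass that starts in `A`. -/
structure IsContractiveRay {X : Type u} [MetricSpace X] [MeasurableSpace X] (K N : ℝ) (o : X)
    (A : Set X) (μ : Measure X) : Prop where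
  isRayFrom : IsRayFrom o μ.support
  map_le : ∀ (t : unitInterval) (T : X → X), Measurable T →
    (∀ᵐ x ∂μ, T x ∈ μ.support ∧ dist (T x) o = (1 - t) * dist x o) →
    (μ.withDensity (A.indicator fun x => tauCoeff K N (1 - t) (dist x o) ^ N)).map T ≤ μ

section Glue

variable {X : Type u} [MetricSpace X] [SecondCountableTopology X] [MeasurableSpace X]
  [BorelSpace X] {K N : ℝ} {o : X} {A : Set X}

/-- The geodesics of almost all rays, chosen measurably, form one contraction plan. The rays may
overlap: a geodesic is chosen for each pair of a ray and a point on it. -/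
lemma exists_isContractionPlan_of_kernel {Q : Type*} [MeasurableSpace Q] {q : Measure Q}
    [SFinite q] (κ : Kernel Q X) [IsMarkovKernel κ] (hA : MeasurableSet A)
    (h : ∀ᵐ a ∂q, IsContractiveRay K N o A (κ a)) :
    ∃ P, IsContractionPlan K N (q.bind κ) o A P := by
  classical
  have : Nonempty X := ⟨o⟩
  obtain ⟨D, hD, hDm, hDq⟩ := exists_measurable_superset_of_null (ae_iff.1 h)
  have hgood (a : Q) (ha : a ∉ D) : IsContractiveRay K N o A (κ a) := by
    by_contra hn
    exact ha (hD hn)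
  set W : Set (Q × X) := {z | z.1 ∉ D ∧ z.2 ∈ (κ z.1).support} with hW
  have hWm : MeasurableSet W :=
    (measurable_fst hDm.compl).inter (measurableSet_mem_support κ)
  have hWae : ∀ᵐ z ∂(q ⊗ₘ κ), z ∈ W := by
    refine Measure.ae_compProd_of_ae_ae hWm ?_
    have : ∀ᵐ a ∂q, a ∉ D := measure_eq_zero_iff_ae_notMem.1 hDq
    filter_upwards [this] with a ha
    filter_upwards [Measure.support_mem_ae (μ := κ a)] with x hx using ⟨ha, hx⟩
  have hex (z : Q × X) : ∃ γ : Geo X, γ.eval 1 = o ∧ (z ∈ W → γ.eval 0 = z.2 ∧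
      ∀ t : unitInterval, γ.eval t ∈ (κ z.1).support ∧
        dist (γ.eval t) o = (1 - t) * dist z.2 o) ∧ (z ∉ W → ∀ t, γ.eval t = o) := by
    by_cases hz : z ∈ W
    · obtain ⟨γ, h0, h1, h2⟩ := (hgood z.1 hz.1).isRayFrom.exists_geo hz.2
      exact ⟨γ, h1, fun _ => ⟨h0, h2⟩, fun hn => absurd hz hn⟩
    · exact ⟨Geo.ofDistEq (fun _ => o) (by simp), rfl, fun hp => absurd hp hz, fun _ _ => rfl⟩
  choose G hG1 hGW hGo using hex
  have hGm : Measurable G := by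
    refine measurable_geo fun t => ?_
    refine measurable_of_tendsto_metrizable (f := fun n z =>
      W.piecewise (fun z => rayApprox o (κ z.1) (1 / (n + 1)) ((1 - t) * dist z.2 o))
        (fun _ => o) z) (fun n => ?_) (tendsto_pi_nhds.2 fun z => ?_)
    · refine Measurable.piecewise hWm ?_ measurable_const
      have hpair : Measurable fun z : Q × X => (z.1, (1 - t : ℝ) * dist z.2 o) := by fun_prop
      exact (measurable_rayApprox κ o (1 / (n + 1))).comp hpair
    · by_cases hz : z ∈ W
      · simp only [piecewise_eq_of_mem _ _ _ hz]
        obtain ⟨hS, hd⟩ := (hGW z hz).2 t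
        rw [tendsto_iff_dist_tendsto_zero]
        refine squeeze_zero (fun _ => dist_nonneg) (fun n => ?_)
          (g := fun n : ℕ => 2 * (1 / ((n : ℝ) + 1))) ?_
        · rw [← hd]
          exact (dist_rayApprox_lt (hgood z.1 hz.1).isRayFrom hS (by positivity)).le
        · simpa using (tendsto_one_div_add_atTop_nhds_zero_nat (𝕜 := ℝ)).const_mul 2
      · simp only [piecewise_eq_of_notMem _ _ _ hz, hGo z hz t]
        exact tendsto_const_nhds
  have hmap0 : ((q ⊗ₘ κ).map G).map (Geo.eval 0) = q.bind κ := by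
    rw [Measure.map_map (Geo.measurable_eval 0) hGm, ← Measure.snd_compProd, Measure.snd]
    refine Measure.map_congr ?_
    filter_upwards [hWae] with z hz using (hGW z hz).1
  refine ⟨(q ⊗ₘ κ).map G, hmap0, ?_, fun t => ?_⟩
  · exact (ae_map_iff hGm.aemeasurable (Geo.measurable_eval 1 (measurableSet_singleton o))).2
      (ae_of_all _ hG1)
  set w : X → ℝ≥0∞ := A.indicator fun x => tauCoeff K N (1 - t) (dist x o) ^ N with hw
  have hwm : Measurable w := by
    refine Measurable.indicator (Measurable.pow_const ?_ _) hA
    exact (measurable_tauCoeff K N (1 - t)).comp (by fun_prop)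
  have hw0 : Measurable fun γ : Geo X => w (γ.eval 0) := hwm.comp (Geo.measurable_eval 0)
  refine Measure.le_iff.2 fun B hB => ?_
  have hBt : MeasurableSet (Geo.eval (X := X) t ⁻¹' B) := Geo.measurable_eval t hB
  rw [Measure.map_apply (Geo.measurable_eval t) hB, withDensity_apply _ hBt,
    setLIntegral_map hBt hw0 hGm,
    Measure.bind_apply hB κ.aemeasurable]
  have hwG : Measurable fun z => w ((G z).eval 0) :=
    hwm.comp ((Geo.measurable_eval 0).comp hGm)
  rw [← lintegral_indicator (hGm hBt), Measure.lintegral_compProd (hwG.indicator (hGm hBt))]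
  refine lintegral_mono_ae ?_
  filter_upwards [Measure.ae_ae_of_ae_compProd hWae, h] with a ha hga
  have hGa : Measurable fun x => (G (a, x)).eval t :=
    (Geo.measurable_eval t).comp (hGm.comp measurable_prodMk_left)
  refine le_trans (le_of_eq ?_) (Measure.le_iff.1 (hga.map_le t (fun x => (G (a, x)).eval t) hGa
    (ha.mono fun x hx => (hGW _ hx).2 t)) B hB)
  rw [Measure.map_apply hGa hB, withDensity_apply _ (hGa hB), ← lintegral_indicator (hGa hB)]
  refine lintegral_congr_ae ?_
  filter_upwards [ha] with x hx
  simp only [indicator, mem_preimage, (hGW _ hx).1]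
  rfl

end Glue

/-! ### The contraction plan of `MCP¹` -/

section Conditional

variable {X : Type u} [MetricSpace X] [MeasurableSpace X] [BorelSpace X]

lemma isP2_cond_of_subset_closedBall {m : Measure X} [IsFiniteMeasure m] {A : Set X}
    (hA : MeasurableSet A) (h0 : m A ≠ 0) {o : X} {R : ℝ} (hAR : A ⊆ Metric.closedBall o R) :
    IsP2 ((m A)⁻¹ • m.restrict A) := by
  have : IsProbabilityMeasure ((m A)⁻¹ • m.restrict A) :=
    ProbabilityTheory.cond_isProbabilityMeasure h0
  refine (isP2_iff o).2 ?_
  calc ∫⁻ x, edist x o ^ 2 ∂((m A)⁻¹ • m.restrict A)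
      ≤ ∫⁻ _, ENNReal.ofReal R ^ 2 ∂((m A)⁻¹ • m.restrict A) := by
        refine lintegral_mono_ae (Measure.ae_smul_measure ?_ _)
        filter_upwards [ae_restrict_mem hA] with x hx
        gcongr
        rw [edist_dist]
        exact ENNReal.ofReal_le_ofReal (hAR hx)
    _ < ∞ := by simp

end Conditional

section Fibre

lemma map_onSubspace {X : Type*} [MeasurableSpace X] {m : Measure X} {S : Set X}
    (hS : MeasurableSet S) (h : m Sᶜ = 0) :
    (onSubspace m S).map Subtype.val = m := by
  rw [map_comap_subtype_coe hS, Measure.restrict_eq_self_of_ae_mem]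
  exact h

lemma isProbabilityMeasure_onSubspace {X : Type*} [MeasurableSpace X] {m : Measure X}
    [IsProbabilityMeasure m] {S : Set X} (hS : MeasurableSet S) (h : m Sᶜ = 0) :
    IsProbabilityMeasure (onSubspace m S) := by
  refine ⟨?_⟩
  rw [← preimage_univ (f := (Subtype.val : S → X)), ← Measure.map_apply measurable_subtype_coe
    .univ, map_onSubspace hS h, measure_univ]

lemma transportSet_dist {X : Type u} [MetricSpace X] [Nontrivial X] (o : X) :
    transportSet (fun x => dist x o) = univ := by
  refine eq_univ_of_forall fun x => ?_
  by_cases hx : x = o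
  · obtain ⟨y, hy⟩ := exists_ne x
    exact ⟨y, hy, Or.inr (by simp [Gam, hx])⟩
  · exact ⟨o, Ne.symm hx, Or.inl (by simp [Gam])⟩

/-- In a one-point space the transport set is empty and the constant geodesic is the plan. -/
lemma exists_isContractionPlan_of_subsingleton {X : Type u} [MetricSpace X]
    [MeasurableSpace X] [BorelSpace X] [Subsingleton X] {K N : ℝ} {o : X} (hN : 1 < N)
    (m : Measure X) [IsProbabilityMeasure m] (A : Set X) : ∃ P, IsContractionPlan K N m o A P := by
  have hm (s : Set X) (hs : s.Nonempty) : m s = 1 := by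
    rw [hs.eq_univ, measure_univ]
  refine ⟨Measure.dirac (Geo.ofDistEq (fun _ => o) (by simp)), ?_, ?_, fun t => ?_⟩
  · ext s hs
    rw [Measure.map_apply (Geo.measurable_eval 0) hs]
    rcases s.eq_empty_or_nonempty with rfl | h
    · simp
    · rw [hm s h, h.eq_univ]
      simp
  · exact ae_of_all _ fun γ => Subsingleton.elim _ _
  · refine Measure.le_iff.2 fun s hs => ?_
    rcases s.eq_empty_or_nonempty with rfl | h
    · simp
    rw [hm s h, Measure.map_apply (Geo.measurable_eval t) hs,
      withDensity_apply _ (Geo.measurable_eval t hs)]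
    refine (setLIntegral_le_lintegral _ _).trans ?_
    refine (lintegral_mono (g := fun _ => 1) fun γ => ?_).trans (by simp)
    refine (indicator_le_self _ _ _).trans ?_
    rw [Subsingleton.elim (γ.eval 0) o, dist_self, tauCoeff_zero_right hN]
    refine ENNReal.rpow_le_one ?_ (by linarith)
    exact ENNReal.ofReal_le_one.2 (by linarith [t.2.1])

variable {X : Type u} [MetricSpace X] [SecondCountableTopology X] [MeasurableSpace X]
  [BorelSpace X] {K N : ℝ} {o : X}

/-- On a ray the plan provided by `MCP(K,N)` moves every point along the ray towards `o`, whence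
its density bound is the one for the contraction of the ray. -/
lemma isContractiveRay_of_mcpAt {μ : Measure X} [IsProbabilityMeasure μ]
    {S : Set X} (hS : μ.support = S) (hray : IsRayFrom o S) (ho : o ∈ S)
    (h : MCPAt K N (onSubspace μ S) ⟨o, ho⟩) {R : ℝ}
    (hR : 0 < K → R ≤ Real.pi * √((N - 1) / K)) :
    IsContractiveRay K N o (Metric.ball o R) μ := by
  refine ⟨hS ▸ hray, fun t T hT hTae => ?_⟩
  rw [hS] at hTae
  have hSm : MeasurableSet S := hS ▸ Measure.isClosed_support.measurableSet
  have hSc : μ Sᶜ = 0 := hS ▸ Measure.support_mem_ae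
  set mS := onSubspace μ S with hmS
  have hmap : mS.map Subtype.val = μ := map_onSubspace hSm hSc
  have : IsProbabilityMeasure mS := isProbabilityMeasure_onSubspace hSm hSc
  set A := Metric.ball o R with hA
  have hAm : MeasurableSet A := Metric.isOpen_ball.measurableSet
  set A' : Set S := Subtype.val ⁻¹' A with hA'
  have hA'm : MeasurableSet A' := measurable_subtype_coe hAm
  have hA'o : A' ⊆ Metric.ball (⟨o, ho⟩ : S) R := fun x hx => hx
  set w : X → ℝ≥0∞ := fun x => tauCoeff K N (1 - t) (dist x o) ^ N with hw
  have hwm : Measurable w :=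
    ((measurable_tauCoeff K N (1 - t)).comp (by fun_prop)).pow_const _
  refine Measure.le_iff.2 fun B hB => ?_
  set F : X → ℝ≥0∞ := (T ⁻¹' B).indicator (A.indicator w) with hF
  have hFm : Measurable F := (hwm.indicator hAm).indicator (hT hB)
  have hL : ((μ.withDensity (A.indicator w)).map T) B = ∫⁻ x in A', F x ∂mS := by
    rw [Measure.map_apply hT hB, withDensity_apply _ (hT hB), ← lintegral_indicator (hT hB),
      ← hF, ← hmap, lintegral_map hFm measurable_subtype_coe, ← lintegral_indicator hA'm]
    refine lintegral_congr fun x => ?_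
    by_cases hx : x ∈ A'
    · rw [indicator_of_mem hx]
    · rw [indicator_of_notMem hx, hF]
      have hx' : (x : X) ∉ A := hx
      simp [indicator, hx']
  rw [hL]
  rcases eq_or_ne (mS A') 0 with h0 | h0
  · rw [Measure.restrict_eq_zero.2 h0]
    simp
  obtain ⟨ν, hν, hνt⟩ := h.2 A' hA'm (pos_iff_ne_zero.2 h0) (measure_lt_top _ _)
    (fun hK => hA'o.trans (Metric.ball_subset_ball (hR hK)))
    (isP2_cond_of_subset_closedBall hA'm h0 (hA'o.trans Metric.ball_subset_closedBall))
  obtain ⟨hνp, -, -, hν0, hν1⟩ := hν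
  have hone : ∀ᵐ γ ∂ν, γ.eval 1 = (⟨o, ho⟩ : S) := by
    have hd : ∀ᵐ x ∂(ν.map (Geo.eval 1)), x = (⟨o, ho⟩ : S) := by
      rw [hν1]
      exact (ae_dirac_iff (measurableSet_singleton _)).2 rfl
    exact ae_of_ae_map (Geo.measurable_eval 1).aemeasurable hd
  have hTν : ∀ᵐ γ ∂ν, T (γ.eval 0 : S) ∈ S ∧
      dist (T (γ.eval 0 : S)) o = (1 - t) * dist ((γ.eval 0 : S) : X) o := by
    refine ae_of_ae_map (f := fun γ : Geo S => γ.eval 0)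
      (p := fun x : S => T x ∈ S ∧ dist (T x) o = (1 - t) * dist (x : X) o)
      (Geo.measurable_eval 0).aemeasurable ?_
    change ∀ᵐ x ∂(ν.map (Geo.eval 0)), _
    rw [hν0]
    refine Measure.ae_smul_measure (ae_restrict_of_ae ?_) _
    rw [← hmap] at hTae
    exact ae_of_ae_map measurable_subtype_coe.aemeasurable hTae
  set B' : Set S := Subtype.val ⁻¹' B with hB'
  have hB'm : MeasurableSet B' := measurable_subtype_coe hB
  have hsc : ∫⁻ x in A', F x ∂mS = mS A' * ∫⁻ γ, F (γ.eval 0 : S) ∂ν := by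
    rw [← lintegral_map (f := fun x : S => F x) (hFm.comp measurable_subtype_coe)
      (Geo.measurable_eval 0), hν0, lintegral_smul_measure, smul_eq_mul, ← mul_assoc,
      ENNReal.mul_inv_cancel h0 (measure_ne_top _ _), one_mul]
  have hle : ∫⁻ γ, F (γ.eval 0 : S) ∂ν ≤ (mS A')⁻¹ * mS B' := by
    have := Measure.le_iff.1 (hνt t) B' hB'm
    rw [Measure.map_apply (Geo.measurable_eval t) hB'm,
      withDensity_apply _ (Geo.measurable_eval t hB'm),
      ← lintegral_indicator (Geo.measurable_eval t hB'm)] at this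
    refine le_trans (lintegral_mono_ae ?_) this
    filter_upwards [hone, hTν] with γ h1 h2
    have hγt : T (γ.eval 0 : S) = (γ.eval t : S) := by
      refine hray.eq_of_dist_eq h2.1 (γ.eval t).2 (h2.2.trans ?_)
      have := γ.dist_eval_one t
      rw [h1] at this
      exact this.symm
    by_cases hb : ((γ.eval t : S) : X) ∈ B
    · have hb' : γ ∈ Geo.eval t ⁻¹' B' := hb
      rw [indicator_of_mem hb', h1]
      exact (indicator_le_self _ _ _).trans (indicator_le_self _ _ _)
    · have hb' : ((γ.eval 0 : S) : X) ∉ T ⁻¹' B := by rwa [mem_preimage, hγt]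
      rw [hF, indicator_of_notMem hb']
      exact zero_le
  have hfinal : mS B' = μ B := by
    conv_rhs => rw [← hmap, Measure.map_apply measurable_subtype_coe hB]
  calc ∫⁻ x in A', F x ∂mS ≤ mS A' * ((mS A')⁻¹ * mS B') := by rw [hsc]; gcongr
    _ = μ B := by
      rw [← mul_assoc, ENNReal.mul_inv_cancel h0 (measure_ne_top _ _), one_mul, hfinal]

/-- A family of probability measures that is almost everywhere measurable on each Borel set agrees
almost everywhere with a Markov kernel, as a countable family of Borel sets determines a
probability measure. -/
lemma exists_kernel_ae_eq [Nonempty X] {Q : Type*} [MeasurableSpace Q] {q : Measure Q}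
    {mα : Q → Measure X} (hp : ∀ a, IsProbabilityMeasure (mα a))
    (hm : ∀ B, MeasurableSet B → AEMeasurable (fun a => mα a B) q) :
    ∃ κ : Kernel Q X, IsMarkovKernel κ ∧ ∀ᵐ a ∂q, κ a = mα a := by
  classical
  set b := TopologicalSpace.countableBasis X with hb
  have hbasis := TopologicalSpace.isBasis_countableBasis X
  set C : Set (Set X) := (fun f => ⋂₀ f) '' {f : Set (Set X) | f.Finite ∧ f ⊆ b} with hC
  have hCc : C.Countable :=
    (Set.countable_ofPred_finite_subset (TopologicalSpace.countable_countableBasis X)).image _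
  have hCb : TopologicalSpace.IsTopologicalBasis C :=
    TopologicalSpace.isTopologicalBasis_of_subbasis hbasis.eq_generateFrom
  have hgen : ‹MeasurableSpace X› = .generateFrom C :=
    (BorelSpace.measurable_eq (α := X)).trans (hCb.borel_eq_generateFrom)
  have hpi : IsPiSystem C := by
    rintro _ ⟨f, hf, rfl⟩ _ ⟨g, hg, rfl⟩ -
    exact ⟨f ∪ g, ⟨hf.1.union hg.1, union_subset hf.2 hg.2⟩, sInter_union f g⟩
  have hCm (s : Set X) (hs : s ∈ C) : MeasurableSet s := (hCb.isOpen hs).measurableSet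
  have : Countable C := hCc
  have hae : ∀ᵐ a ∂q, ∀ s : C, mα a s = (hm s (hCm s s.2)).mk _ a :=
    ae_all_iff.2 fun s => (hm s (hCm s s.2)).ae_eq_mk
  obtain ⟨D, hD, hDm, hDq⟩ := exists_measurable_superset_of_null (ae_iff.1 hae)
  obtain ⟨x₀⟩ := ‹Nonempty X›
  set f : Q → Measure X := fun a => if a ∈ D then Measure.dirac x₀ else mα a with hf
  have hfp (a : Q) : IsProbabilityMeasure (f a) := by
    rw [hf]
    dsimp only
    split_ifs
    · infer_instance
    · exact hp a
  have hfm : Measurable f := by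
    refine Measurable.measure_of_isPiSystem_of_isProbabilityMeasure hgen hpi fun s hs => ?_
    have : (fun a => f a s) =
        D.piecewise (fun _ => Measure.dirac x₀ s) ((hm s (hCm s hs)).mk _) := by
      ext a
      by_cases ha : a ∈ D
      · simp [hf, ha]
      · have : ∀ s : C, mα a s = (hm s (hCm s s.2)).mk _ a := by
          by_contra hn
          exact ha (hD hn)
        simp [hf, ha, this ⟨s, hs⟩]
    rw [this]
    exact measurable_const.piecewise hDm (hm s (hCm s hs)).measurable_mk
  refine ⟨⟨f, hfm⟩, ⟨hfp⟩, ?_⟩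
  have hDae : ∀ᵐ a ∂q, a ∉ D := measure_eq_zero_iff_ae_notMem.1 hDq
  filter_upwards [hDae] with a ha
  change f a = _
  simp [hf, ha]

/-- Under `MCP¹_u` with `u = d(·, o)` the whole space admits a contraction plan towards `o`, since
almost all rays of `u` issue from `o` and, unless the space is a single point, its transport set is
everything. The radius `R` only limits the starting points to those that `MCP(K,N)` allows. -/
lemma exists_isContractionPlan_of_mcp1u (hN : 1 < N) {m : Measure X} [IsProbabilityMeasure m]
    (h : MCP1u K N m o) {R : ℝ} (hR : 0 < K → R ≤ Real.pi * √((N - 1) / K)) :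
    ∃ P, IsContractionPlan K N m o (Metric.ball o R) P := by
  rcases subsingleton_or_nontrivial X with hX | hX
  · exact exists_isContractionPlan_of_subsingleton hN m _
  obtain ⟨Q, _, q, Xα, mα, hd, hmcp⟩ := h
  obtain ⟨κ, hκ, hκα⟩ := exists_kernel_ae_eq hd.prob hd.measurable
  have hdis (B : Set X) (hB : MeasurableSet B) : m B = ∫⁻ a, mα a B ∂q := by
    rw [← hd.disint B hB, transportSet_dist, Measure.restrict_univ]
  have hq : IsFiniteMeasure q := by
    refine ⟨?_⟩
    have := hdis univ .univ
    simp only [(hd.prob _).measure_univ, measure_univ, lintegral_one] at this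
    rw [← this]
    exact ENNReal.one_lt_top
  have hbind : q.bind κ = m := by
    ext B hB
    rw [Measure.bind_apply hB κ.aemeasurable, hdis B hB]
    refine lintegral_congr_ae ?_
    filter_upwards [hκα] with a ha
    rw [ha]
  rw [← hbind]
  refine exists_isContractionPlan_of_kernel κ Metric.isOpen_ball.measurableSet ?_
  filter_upwards [hκα, hd.ray, hd.support, hmcp] with a h1 h2 h3 ⟨ho, h4⟩
  have hray := h2.mem_and_isRayFrom.2
  rw [h1]
  have := hd.prob a
  exact isContractiveRay_of_mcpAt h3 hray ho h4 hR

end Fibre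

/-! ### From the support to the whole space -/

section Transfer

variable {X : Type u} [MetricSpace X] [SecondCountableTopology X] [MeasurableSpace X]
  [BorelSpace X] {K N : ℝ}

/-- A geodesic of a subspace, seen as a geodesic of the space. -/
def Geo.ofSubspace {S : Set X} (γ : Geo S) : Geo X :=
  Geo.ofDistEq (fun t => ((γ.eval t : S) : X)) γ.dist_eval

lemma Geo.measurable_ofSubspace {S : Set X} : Measurable (Geo.ofSubspace (S := S)) :=
  measurable_geo fun t => measurable_subtype_coe.comp (Geo.measurable_eval t)

lemma IsContractionPlan.map_ofSubspace {S : Set X} {o : S} {m : Measure S} {A : Set X}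
    (hA : MeasurableSet A) {P : Measure (Geo S)}
    (h : IsContractionPlan K N m o (Subtype.val ⁻¹' A) P) :
    IsContractionPlan K N (m.map Subtype.val) (o : X) A (P.map Geo.ofSubspace) := by
  have he (t : unitInterval) : Geo.eval t ∘ Geo.ofSubspace (S := S) =
      Subtype.val ∘ Geo.eval t := rfl
  have hcomp (μ : Measure (Geo S)) (t : unitInterval) :
      (μ.map Geo.ofSubspace).map (Geo.eval t) = (μ.map (Geo.eval t)).map Subtype.val := by
    rw [Measure.map_map (Geo.measurable_eval t) Geo.measurable_ofSubspace, he,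
      Measure.map_map measurable_subtype_coe (Geo.measurable_eval t)]
  refine ⟨by rw [hcomp, h.map_eval_zero], ?_, fun t => ?_⟩
  · refine (ae_map_iff Geo.measurable_ofSubspace.aemeasurable
      (Geo.measurable_eval 1 (measurableSet_singleton _))).2 ?_
    filter_upwards [h.ae_eval_one] with γ hγ
    exact congrArg Subtype.val hγ
  · have hwm : Measurable (A.indicator fun x => tauCoeff K N (1 - t) (dist x (o : X)) ^ N) :=
      (((measurable_tauCoeff K N (1 - t)).comp (by fun_prop)).pow_const _).indicator hA
    have hwe : Measurable fun γ : Geo X =>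
        A.indicator (fun x => tauCoeff K N (1 - t) (dist x (o : X)) ^ N) (γ.eval 0) :=
      hwm.comp (Geo.measurable_eval 0)
    rw [← map_withDensity_comp P Geo.measurable_ofSubspace hwe, hcomp]
    exact Measure.map_mono (h.map_eval_le t) measurable_subtype_coe

theorem MCP1.mcpEps (hN : 1 < N) {m : Measure X} [IsProbabilityMeasure m] (h : MCP1 K N m) :
    MCPeps K N m := by
  intro o ho μ₀ hμ₀ hbd hball
  obtain ⟨R, hR, hsupp⟩ : ∃ R : ℝ, (0 < K → R ≤ Real.pi * √((N - 1) / K)) ∧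
      μ₀.support ⊆ Metric.ball o R := by
    by_cases hK : 0 < K
    · exact ⟨_, fun _ => le_rfl, hball hK⟩
    · obtain ⟨R, hR⟩ := hbd.subset_ball o
      exact ⟨R, fun h => absurd h hK, hR⟩
  have hSm : MeasurableSet m.support := Measure.isClosed_support.measurableSet
  have hmap : (onSubspace m m.support).map Subtype.val = m :=
    map_onSubspace hSm Measure.support_mem_ae
  have : IsProbabilityMeasure (onSubspace m m.support) :=
    isProbabilityMeasure_onSubspace hSm Measure.support_mem_ae
  obtain ⟨P, hP⟩ := exists_isContractionPlan_of_mcp1u hN (h ⟨o, ho⟩) hR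
  have hP' := hP.map_ofSubspace (A := Metric.ball o R) Metric.isOpen_ball.measurableSet
  rw [hmap] at hP'
  obtain ⟨ν, hν, hac, hle⟩ := hP'.exists_optGeo hN Metric.isOpen_ball.measurableSet hμ₀
    (measure_mono_null (compl_subset_compl.2 hsupp) Measure.support_mem_ae)
  refine ⟨ν, hν, fun t _ => ⟨?_, hle t⟩⟩
  refine Measure.support_subset_of_isClosed Measure.isClosed_support ?_
  refine (ae_map_iff (Geo.measurable_eval t).aemeasurable hSm).2 (hac.ae_le ?_)
  refine (ae_map_iff Geo.measurable_ofSubspace.aemeasurable (Geo.measurable_eval t hSm)).2 ?_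
  exact ae_of_all _ fun γ => (γ.eval t).2

end Transfer

/-! ### Continuity of the distortion coefficients -/

lemma continuousAt_ratio {f : ℝ → ℝ} {t k θ₀ : ℝ} (hk : k ≠ 0) (hf : Continuous f) (h0 : f 0 = 0)
    (hd : HasDerivAt f 1 0) (hne : θ₀ ≠ 0 → f (θ₀ * k) ≠ 0) :
    ContinuousAt (fun θ => if θ = 0 then t else f (t * θ * k) / f (θ * k)) θ₀ := by
  rcases eq_or_ne θ₀ 0 with rfl | hθ
  · rw [continuousAt_iff_punctured_nhds]
    have h1 : HasDerivAt (fun θ : ℝ => f (t * θ * k)) (t * k) 0 := by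
      have hl : HasDerivAt (fun θ : ℝ => t * θ * k) (t * k) 0 := by
        simpa using ((hasDerivAt_id (0 : ℝ)).const_mul t).mul_const k
      have := HasDerivAt.comp (0 : ℝ) (h₂ := f) (h := fun θ : ℝ => t * θ * k) (h₂' := 1)
        (by simpa using hd) hl
      simpa [Function.comp_def] using this
    have h2 : HasDerivAt (fun θ : ℝ => f (θ * k)) k 0 := by
      have hl : HasDerivAt (fun θ : ℝ => θ * k) k 0 := by
        simpa using (hasDerivAt_id (0 : ℝ)).mul_const k
      have := HasDerivAt.comp (0 : ℝ) (h₂ := f) (h := fun θ : ℝ => θ * k) (h₂' := 1)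
        (by simpa using hd) hl
      simpa [Function.comp_def] using this
    have h3 := h1.tendsto_slope.div h2.tendsto_slope hk
    rw [mul_div_cancel_right₀ _ hk] at h3
    simp only [if_true]
    refine h3.congr' ?_
    filter_upwards [self_mem_nhdsWithin] with θ hθ
    have hθ' : θ ≠ 0 := hθ
    simp only [Pi.div_apply, slope_def_field, mul_zero, zero_mul, h0, sub_zero, if_neg hθ']
    exact div_div_div_cancel_right₀ hθ' _ _
  · have : (fun θ => if θ = 0 then t else f (t * θ * k) / f (θ * k)) =ᶠ[𝓝 θ₀]
        fun θ => f (t * θ * k) / f (θ * k) := by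
      filter_upwards [isOpen_ne.mem_nhds hθ] with θ h
      exact if_neg h
    rw [continuousAt_congr this]
    exact ContinuousAt.div (by fun_prop) (by fun_prop) (hne hθ)

lemma pi_mul_sqrt_div (K n : ℝ) : Real.pi * √(n / K) = Real.pi / √(K / n) := by
  rw [← inv_div K n, Real.sqrt_inv, ← div_eq_mul_inv]

lemma continuousAt_sigmaCoeff {K n t θ₀ : ℝ} (hn : 0 < n) (hθ₀ : 0 ≤ θ₀)
    (hK : 0 < K → θ₀ < Real.pi * √(n / K)) : ContinuousAt (sigmaCoeff K n t) θ₀ := by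
  rcases lt_trichotomy K 0 with h | rfl | h
  · have hk : √(-K / n) ≠ 0 := (Real.sqrt_pos.2 (div_pos (neg_pos.2 h) hn)).ne'
    have hc := continuousAt_ratio (t := t) (θ₀ := θ₀) hk Real.continuous_sinh Real.sinh_zero
      (by simpa using Real.hasDerivAt_sinh 0) (fun h0 => by
        rw [Ne, Real.sinh_eq_zero]; exact mul_ne_zero h0 hk)
    refine (ENNReal.continuous_ofReal.continuousAt.comp hc).congr (Eventually.of_forall fun θ => ?_)
    simp only [Function.comp, sigmaCoeff, h.ne, or_false, not_lt.2 h.le, if_false]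
    split_ifs <;> rfl
  · have : sigmaCoeff 0 n t = fun _ => ENNReal.ofReal t := by
      ext θ
      simp [sigmaCoeff]
    rw [this]
    exact continuousAt_const
  · have hk : 0 < √(K / n) := Real.sqrt_pos.2 (div_pos h hn)
    have hlt := hK h
    rw [pi_mul_sqrt_div] at hlt
    have hc := continuousAt_ratio (t := t) (θ₀ := θ₀) hk.ne' Real.continuous_sin Real.sin_zero
      (by simpa using Real.hasDerivAt_sin 0) (fun h0 =>
        (Real.sin_pos_of_pos_of_lt_pi (mul_pos (hθ₀.lt_of_ne' h0) hk)
          ((lt_div_iff₀ hk).1 hlt)).ne')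
    refine (ENNReal.continuous_ofReal.continuousAt.comp hc).congr ?_
    filter_upwards [isOpen_Iio.mem_nhds hlt] with θ hθ
    have hθ' : θ < Real.pi / √(K / n) := hθ
    simp only [Function.comp, sigmaCoeff, h.ne', or_false, h, hθ', if_true]
    split_ifs <;> rfl

lemma continuousAt_tauCoeff {K N t θ₀ : ℝ} (hN : 1 < N) (hθ₀ : 0 ≤ θ₀)
    (hK : 0 < K → θ₀ < Real.pi * √((N - 1) / K)) : ContinuousAt (tauCoeff K N t) θ₀ := by
  have h1 := continuousAt_sigmaCoeff (t := t) (sub_pos.2 hN) hθ₀ hK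
  have hfin : ENNReal.ofReal t ^ (1 / N) ≠ ∞ :=
    ENNReal.rpow_ne_top_of_nonneg (by positivity) ENNReal.ofReal_ne_top
  exact (ENNReal.continuous_const_mul hfin).continuousAt.comp
    ((ENNReal.continuous_rpow_const (y := 1 - 1 / N)).continuousAt.comp h1)

/-! ### Measure contraction on a ray -/

section Contraction

/-- Hölder's inequality: the entropy of a measure concentrated on `S` is at most `m(S) ^ (1/N)`. -/
lemma renyi_le_measure_rpow {X : Type u} [MeasurableSpace X] {N : ℝ} (hN : 1 < N)
    {m μ : Measure X} [SigmaFinite m] [IsProbabilityMeasure μ] {S : Set X}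
    (hS : MeasurableSet S) (h : μ Sᶜ = 0) : renyi N m μ ≤ m S ^ (1 / N) := by
  have hN0 : 0 < N := by linarith
  have hp : 0 < 1 - 1 / N := by rw [sub_pos, div_lt_one hN0]; exact hN
  have hconj : (1 / (1 - 1 / N)).HolderConjugate N := by
    rw [Real.holderConjugate_iff]
    refine ⟨by rw [lt_div_iff₀ hp]; linarith [show 0 < 1 / N by positivity], ?_⟩
    rw [one_div, inv_inv]; field_simp; ring
  set ρ := μ.rnDeriv m with hρ
  have hρm : Measurable ρ := Measure.measurable_rnDeriv _ _
  have hρS : ∀ᵐ x ∂m, x ∉ S → ρ x = 0 := by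
    have h0 : ∫⁻ x in Sᶜ, ρ x ∂m = 0 :=
      le_antisymm ((Measure.setLIntegral_rnDeriv_le _).trans h.le) zero_le
    exact (ae_restrict_iff' hS.compl).1 ((lintegral_eq_zero_iff hρm).1 h0)
  have hone : ∫⁻ x, ρ x ∂m ≤ 1 := by
    refine Measure.lintegral_rnDeriv_le.trans ?_
    rw [measure_univ]
  calc renyi N m μ = ∫⁻ x, ((fun x => ρ x ^ (1 - 1 / N)) * (S.indicator 1 : X → ℝ≥0∞)) x ∂m := by
        refine lintegral_congr_ae ?_
        filter_upwards [hρS] with x hx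
        by_cases hxS : x ∈ S
        · simp [hxS, hρ]
        · have := hx hxS
          rw [← hρ, this, Pi.mul_apply, indicator_of_notMem hxS, mul_zero,
            ENNReal.zero_rpow_of_pos hp]
    _ ≤ (∫⁻ x, (ρ x ^ (1 - 1 / N)) ^ (1 / (1 - 1 / N)) ∂m) ^ (1 / (1 / (1 - 1 / N))) *
          (∫⁻ x, (S.indicator 1 x : ℝ≥0∞) ^ N ∂m) ^ (1 / N) :=
        ENNReal.lintegral_mul_le_Lp_mul_Lq m hconj (hρm.pow_const _).aemeasurable
          (measurable_one.indicator hS).aemeasurable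
    _ ≤ 1 * m S ^ (1 / N) := by
        gcongr
        · simp_rw [← ENNReal.rpow_mul, mul_one_div_cancel hp.ne', ENNReal.rpow_one]
          refine ENNReal.rpow_le_one hone ?_
          rw [one_div_one_div]; exact hp.le
        · have : (fun x => (S.indicator 1 x : ℝ≥0∞) ^ N) = S.indicator 1 := by
            ext x
            by_cases hx : x ∈ S <;> simp [hx, hN0]
          rw [this, lintegral_indicator_one hS]
    _ = m S ^ (1 / N) := one_mul _

lemma withDensity_le_of_forall_const {X : Type*} [MeasurableSpace X] {m m' : Measure X}
    {w : X → ℝ≥0∞}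
    (h : ∀ E, MeasurableSet E → ∀ c, (∀ x ∈ E, c ≤ w x) → c * m E ≤ m' E) :
    m.withDensity w ≤ m' := by
  refine Measure.le_iff.2 fun s hs => ?_
  rw [withDensity_apply _ hs, lintegral]
  refine iSup₂_le fun g hg => ?_
  rw [SimpleFunc.lintegral]
  calc ∑ c ∈ g.range, c * m.restrict s (g ⁻¹' {c})
      ≤ ∑ c ∈ g.range, m' (g ⁻¹' {c} ∩ s) := by
        refine Finset.sum_le_sum fun c _ => ?_
        rw [Measure.restrict_apply (g.measurableSet_fiber c)]
        refine h _ ((g.measurableSet_fiber c).inter hs) c fun x hx => ?_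
        have : g x = c := hx.1
        rw [← this]
        exact hg x
    _ = ∑ c ∈ g.range, m'.restrict s (g ⁻¹' {c}) := by
        refine Finset.sum_congr rfl fun c _ => ?_
        rw [Measure.restrict_apply (g.measurableSet_fiber c)]
    _ = m' s := by
        rw [SimpleFunc.sum_range_measure_preimage_singleton, Measure.restrict_apply_univ]

lemma rnDeriv_cond_ae_eq {X : Type*} [MeasurableSpace X] {m : Measure X} [IsFiniteMeasure m]
    {E : Set X} (hE : MeasurableSet E) (h0 : m E ≠ 0) :
    ∀ᵐ x ∂m, x ∈ E → ((m E)⁻¹ • m.restrict E).rnDeriv m x = (m E)⁻¹ := by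
  have h1 := Measure.rnDeriv_smul_left_of_ne_top' (m.restrict E) m (ENNReal.inv_ne_top.2 h0)
  filter_upwards [h1, Measure.rnDeriv_restrict_self m hE] with x h1 h2 hx
  rw [h1, Pi.smul_apply, h2, indicator_of_mem hx]
  simp

variable {X : Type u} [MetricSpace X] [SecondCountableTopology X] [MeasurableSpace X]
  [BorelSpace X] {K N : ℝ} {o : X} {m : Measure X}

/-- Brunn–Minkowski inequality for a compact set and a small ball around `o`, in the limit of
vanishing radius. Only the convergence of intermediate points is used, so that neither uniqueness
nor the form of the optimal plan matters. -/
lemma IsRayFrom.mul_measure_rpow_le (hray : IsRayFrom o (univ : Set X)) [IsProbabilityMeasure m]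
    (hN : 1 < N) (hCD : CD K N m) (ho : o ∈ m.support) {t : unitInterval} {T : X → X}
    (hT : Continuous T) (hTo : ∀ x, dist (T x) o = (1 - t) * dist x o) {E : Set X}
    (hE : IsCompact E) (hEK : 0 < K → E ⊆ Metric.ball o (Real.pi * √((N - 1) / K))) {a : ℝ≥0∞}
    (ha : ∀ x ∈ E, a < tauCoeff K N (1 - t) (dist x o)) :
    a * m E ^ (1 / N) ≤ m (T '' E) ^ (1 / N) := by
  have hN0 : 0 < N := by linarith
  have hEm := hE.isClosed.measurableSet
  rcases eq_or_ne (m E) 0 with h0 | h0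
  · rw [h0, ENNReal.zero_rpow_of_pos (by positivity), mul_zero]
    exact zero_le
  have hF : IsClosed (T '' E) := (hE.image hT).isClosed
  -- the bound `a` persists when the distance to `o` changes by less than `δ`
  obtain ⟨δ, hδ, hδE⟩ : ∃ δ > 0, ∀ x ∈ E, ∀ θ, |θ - dist x o| < δ →
      a < tauCoeff K N (1 - t) θ := by
    have hcomp : IsCompact ((fun x => dist x o) '' E) := hE.image (by fun_prop)
    obtain ⟨δ, hδ, hsub⟩ := hcomp.exists_thickening_subset_open
      (isOpen_setOfPred_eventually_nhds (p := fun θ => a < tauCoeff K N (1 - t) θ)) (by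
        rintro _ ⟨x, hx, rfl⟩
        exact (continuousAt_tauCoeff hN dist_nonneg fun hK => hEK hK hx).eventually
          (lt_mem_nhds (ha x hx)))
    refine ⟨δ, hδ, fun x hx θ hθ => ?_⟩
    have hmem : θ ∈ Metric.thickening δ ((fun x => dist x o) '' E) :=
      Metric.mem_thickening_iff.2 ⟨_, ⟨x, hx, rfl⟩, by rwa [Real.dist_eq]⟩
    have hev : ∀ᶠ θ' in 𝓝 θ, a < tauCoeff K N (1 - t) θ' := hsub hmem
    exact hev.self_of_nhds
  have hlim : Tendsto (fun ε => m (Metric.cthickening (2 * ε) (T '' E)) ^ (1 / N)) (𝓝[>] 0)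
      (𝓝 (m (T '' E) ^ (1 / N))) := by
    refine (ENNReal.continuous_rpow_const.tendsto _).comp ?_
    refine (tendsto_measure_cthickening_of_isClosed ⟨1, one_pos, measure_ne_top _ _⟩ hF).comp ?_
    have : Tendsto (fun ε : ℝ => 2 * ε) (𝓝 0) (𝓝 (2 * 0)) := (continuous_const_mul 2).tendsto 0
    rw [mul_zero] at this
    exact this.mono_left nhdsWithin_le_nhds
  refine ge_of_tendsto hlim ?_
  filter_upwards [Ioo_mem_nhdsGT hδ] with ε hε
  have hBm : MeasurableSet (Metric.ball o ε) := Metric.isOpen_ball.measurableSet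
  have hB0 : m (Metric.ball o ε) ≠ 0 :=
    ((Measure.mem_support_iff_forall o).1 ho _ (Metric.ball_mem_nhds o hε.1)).ne'
  obtain ⟨R, hR⟩ := hE.isBounded.subset_closedBall o
  have hac (A : Set X) : (m A)⁻¹ • m.restrict A ≪ m :=
    Measure.smul_absolutelyContinuous.trans Measure.absolutelyContinuous_restrict
  obtain ⟨ν, ⟨hνp, -, -, hν0, hν1⟩, hνt⟩ := hCD _ _
    ⟨isP2_cond_of_subset_closedBall hEm h0 hR, hac E⟩
    ⟨isP2_cond_of_subset_closedBall hBm hB0 Metric.ball_subset_closedBall, hac _⟩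
  have hent := (hνt t).2 N le_rfl
  have hpair : Measurable fun γ : Geo X => (γ.eval 0, γ.eval 1) :=
    (Geo.measurable_eval 0).prodMk (Geo.measurable_eval 1)
  set π := ν.map fun γ : Geo X => (γ.eval 0, γ.eval 1) with hπ
  have hπp : IsProbabilityMeasure π := Measure.isProbabilityMeasure_map hpair.aemeasurable
  have hπ0 : π.map Prod.fst = (m E)⁻¹ • m.restrict E := by
    rw [← hν0, hπ, Measure.map_map measurable_fst hpair]; rfl
  have hπ1 : π.map Prod.snd = (m (Metric.ball o ε))⁻¹ • m.restrict (Metric.ball o ε) := by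
    rw [← hν1, hπ, Measure.map_map measurable_snd hpair]; rfl
  have hE' : ∀ᵐ x ∂((m E)⁻¹ • m.restrict E), x ∈ E :=
    Measure.ae_smul_measure (ae_restrict_mem hEm) _
  have hB' : ∀ᵐ x ∂((m (Metric.ball o ε))⁻¹ • m.restrict (Metric.ball o ε)),
      x ∈ Metric.ball o ε := Measure.ae_smul_measure (ae_restrict_mem hBm) _
  have hlow : a * m E ^ (1 / N) ≤ ∫⁻ z, (tauCoeff K N (1 - t) (dist z.1 z.2) *
      ((m E)⁻¹ • m.restrict E).rnDeriv m z.1 ^ (-(1 / N)) +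
        tauCoeff K N t (dist z.1 z.2) * ((m (Metric.ball o ε))⁻¹ •
          m.restrict (Metric.ball o ε)).rnDeriv m z.2 ^ (-(1 / N))) ∂π := by
    calc a * m E ^ (1 / N) = ∫⁻ _, a * m E ^ (1 / N) ∂π := by simp
      _ ≤ _ := by
        refine lintegral_mono_ae ?_
        have z1 : ∀ᵐ z ∂π, z.1 ∈ E := ae_of_ae_map measurable_fst.aemeasurable (hπ0 ▸ hE')
        have z2 : ∀ᵐ z ∂π, z.2 ∈ Metric.ball o ε :=
          ae_of_ae_map measurable_snd.aemeasurable (hπ1 ▸ hB')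
        have z3 : ∀ᵐ z ∂π, z.1 ∈ E → ((m E)⁻¹ • m.restrict E).rnDeriv m z.1 = (m E)⁻¹ :=
          ae_of_ae_map (f := Prod.fst)
            (p := fun x => x ∈ E → ((m E)⁻¹ • m.restrict E).rnDeriv m x = (m E)⁻¹)
            measurable_fst.aemeasurable (by
              rw [hπ0]; exact (hac E).ae_le (rnDeriv_cond_ae_eq hEm h0))
        filter_upwards [z1, z2, z3] with z h1 h2 h3
        refine le_trans ?_ le_self_add
        rw [h3 h1, ENNReal.inv_rpow, ← ENNReal.rpow_neg, neg_neg]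
        gcongr
        refine (hδE z.1 h1 _ ?_).le
        have h4 : dist z.2 o < ε := h2
        have h5 := abs_dist_sub_le z.2 o z.1
        rw [dist_comm z.2 z.1, dist_comm o z.1] at h5
        linarith [hε.2]
  refine (hlow.trans hent).trans ?_
  have : IsProbabilityMeasure (ν.map (Geo.eval t)) :=
    Measure.isProbabilityMeasure_map (Geo.measurable_eval t).aemeasurable
  refine renyi_le_measure_rpow hN Metric.isClosed_cthickening.measurableSet ?_
  have hmem : ∀ᵐ γ ∂ν, γ.eval t ∈ Metric.cthickening (2 * ε) (T '' E) := by
    have g0 : ∀ᵐ γ ∂ν, γ.eval 0 ∈ E :=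
      ae_of_ae_map (Geo.measurable_eval 0).aemeasurable (hν0 ▸ hE')
    have g1 : ∀ᵐ γ ∂ν, γ.eval 1 ∈ Metric.ball o ε :=
      ae_of_ae_map (Geo.measurable_eval 1).aemeasurable (hν1 ▸ hB')
    filter_upwards [g0, g1] with γ h0 h1
    refine Metric.mem_cthickening_of_dist_le _ (T (γ.eval 0)) _ _ ⟨_, h0, rfl⟩ ?_
    rw [hray.dist_eq _ (mem_univ _) _ (mem_univ _), hTo]
    have h1' : dist (γ.eval 1) o < ε := h1
    have e1 := abs_dist_sub_le (γ.eval 1) o (γ.eval t)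
    have e2 := abs_dist_sub_le (γ.eval 1) o (γ.eval 0)
    rw [dist_comm (γ.eval 1), dist_comm o, γ.dist_eval_one, abs_le] at e1
    rw [dist_comm (γ.eval 1), dist_comm o, abs_le] at e2
    have ht0 : (0 : ℝ) ≤ t := t.2.1
    have ht1 : (0 : ℝ) ≤ 1 - t := by linarith [t.2.2]
    have ε0 := hε.1
    rw [abs_le]
    constructor <;> nlinarith [mul_nonneg ht1 ε0.le]
  rw [Measure.map_apply (Geo.measurable_eval t) Metric.isClosed_cthickening.measurableSet.compl]
  exact hmem

/-- The contraction of a `CD(K,N)` ray towards its endpoint satisfies the density bound: by inner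
regularity the Brunn–Minkowski inequality extends to Borel sets, and the simple functions below
`τ ^ N` reduce the weighted bound to sets on which the weight is bounded below. -/
lemma IsRayFrom.map_withDensity_le [CompleteSpace X] (hray : IsRayFrom o (univ : Set X))
    [IsProbabilityMeasure m] (hN : 1 < N) (hCD : CD K N m) (ho : o ∈ m.support)
    {t : unitInterval} (ht : t < 1) {T : X → X} (hTo : ∀ x, dist (T x) o = (1 - t) * dist x o)
    {A : Set X} (hAK : 0 < K → A ⊆ Metric.ball o (Real.pi * √((N - 1) / K))) :
    (m.withDensity (A.indicator fun x => tauCoeff K N (1 - t) (dist x o) ^ N)).map T ≤ m := by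
  have hN0 : 0 < N := by linarith
  have ht' : (0 : ℝ) < 1 - t := sub_pos.2 (by exact_mod_cast ht)
  have hTd (x y : X) : dist (T x) (T y) = (1 - t) * dist x y := by
    rw [hray.dist_eq _ (mem_univ _) _ (mem_univ _), hTo, hTo, ← mul_sub, abs_mul, abs_of_pos ht',
      ← hray.dist_eq _ (mem_univ _) _ (mem_univ _)]
  have hT : Continuous T :=
    (LipschitzWith.of_dist_le_mul (K := ⟨1 - t, ht'.le⟩) fun x y => (hTd x y).le).continuous
  have hinj : Function.Injective T := fun x y hxy => by
    have := hTd x y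
    rw [hxy, dist_self] at this
    exact dist_eq_zero.1 ((mul_eq_zero.1 this.symm).resolve_left ht'.ne')
  have hTe : MeasurableEmbedding T := hT.measurableEmbedding hinj
  have key : m.withDensity (A.indicator fun x => tauCoeff K N (1 - t) (dist x o) ^ N) ≤
      m.comap T := by
    refine withDensity_le_of_forall_const fun E hE c hc => ?_
    rcases eq_or_ne c 0 with rfl | hc0
    · rw [zero_mul]; exact zero_le
    have hEA : E ⊆ A := fun x hx => by
      by_contra hxA
      have := hc x hx
      rw [indicator_of_notMem hxA] at this
      exact hc0 (le_antisymm this zero_le)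
    rw [hTe.comap_apply]
    -- it suffices to treat compact subsets of `E`
    refine ENNReal.mul_le_of_forall_lt fun c' hc' b hb => ?_
    obtain ⟨C, hCE, hC, hbC⟩ := hE.exists_lt_isCompact hb
    have hcomp : c ^ (1 / N) * m C ^ (1 / N) ≤ m (T '' C) ^ (1 / N) := by
      refine ENNReal.mul_le_of_forall_lt fun a ha d hd => ?_
      refine (mul_le_mul_right hd.le a).trans ?_
      refine hray.mul_measure_rpow_le hN hCD ho hT hTo hC
        (fun hK => (hCE.trans hEA).trans (hAK hK)) fun x hx => ha.trans_le ?_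
      have := hc x (hCE hx)
      rw [indicator_of_mem (hEA (hCE hx))] at this
      rwa [one_div, ENNReal.rpow_inv_le_iff hN0]
    have hcomp' : c * m C ≤ m (T '' C) := by
      rw [← ENNReal.mul_rpow_of_nonneg _ _ (by positivity)] at hcomp
      exact (ENNReal.rpow_le_rpow_iff (by positivity)).1 hcomp
    calc c' * b ≤ c * m C := by gcongr
      _ ≤ m (T '' C) := hcomp'
      _ ≤ m (T '' E) := measure_mono (image_mono hCE)
  refine (Measure.map_mono key hTe.measurable).trans ?_
  rw [hTe.map_comap]
  exact Measure.restrict_le_self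

/-- `CD(K,N)` implies `MCP(K,N)` on a ray, with respect to its endpoint. -/
lemma IsRayFrom.mcpAt_of_cd [CompleteSpace X] (hray : IsRayFrom o (univ : Set X))
    [IsProbabilityMeasure m] (hN : 1 < N) (hCD : CD K N m) (ho : o ∈ m.support) :
    MCPAt K N m o := by
  refine ⟨ho, fun A hA hA0 hA1 hAK hP2 => ?_⟩
  have hN0 : 0 < N := by linarith
  choose G hG0 hG1 hGt using fun x => hray.exists_geo (mem_univ x)
  have hGc (t : unitInterval) : Continuous fun x => (G x).eval t := by
    refine (LipschitzWith.of_dist_le_mul (K := 1) fun x y => ?_).continuous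
    rw [hray.dist_eq _ (mem_univ _) _ (mem_univ _), (hGt x t).2, (hGt y t).2, ← mul_sub, abs_mul,
      ← hray.dist_eq _ (mem_univ _) _ (mem_univ _), NNReal.coe_one]
    refine mul_le_mul_of_nonneg_right ?_ dist_nonneg
    rw [abs_le]
    exact ⟨by linarith [t.2.2], by linarith [t.2.1]⟩
  have hG : Measurable G := measurable_geo fun t => (hGc t).measurable
  set μ := (m A)⁻¹ • m.restrict A with hμ
  have hμp : IsProbabilityMeasure μ := hP2.1
  have hνp : IsProbabilityMeasure (μ.map G) := Measure.isProbabilityMeasure_map hG.aemeasurable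
  have hν0 : (μ.map G).map (Geo.eval 0) = μ := by
    rw [Measure.map_map (Geo.measurable_eval 0) hG]
    convert Measure.map_id
    exact funext hG0
  have hopt := mem_optGeo_dirac (ν := μ.map G) (o := o)
    ((ae_map_iff hG.aemeasurable (Geo.measurable_eval 1 (measurableSet_singleton o))).2
      (ae_of_all _ hG1)) (by rwa [hν0])
  rw [hν0] at hopt
  refine ⟨_, hopt, fun t => ?_⟩
  rcases t.2.2.lt_or_eq with ht | ht
  · have hw : Measurable fun γ : Geo X =>
        tauCoeff K N (1 - t) (dist (γ.eval 0) (γ.eval 1)) ^ N := by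
      refine Measurable.pow_const ?_ _
      exact (measurable_tauCoeff K N (1 - t)).comp
        ((Geo.measurable_eval 0).dist (Geo.measurable_eval 1))
    rw [← map_withDensity_comp μ hG hw, Measure.map_map (Geo.measurable_eval t) hG]
    simp only [hG0, hG1]
    rw [hμ, withDensity_smul_measure, ← withDensity_indicator hA, Measure.map_smul]
    gcongr
    exact hray.map_withDensity_le hN hCD ho ht (fun x => (hGt x t).2) hAK
  · have : (t : ℝ) = 1 := ht
    simp only [this, sub_self, tauCoeff_zero_left hN, ENNReal.zero_rpow_of_pos hN0]
    simpa using Measure.zero_le _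

end Contraction

/-! ### From `CD¹` to `MCP¹` -/

section Implications

variable {X : Type u} [MetricSpace X] [MeasurableSpace X] [BorelSpace X] {K N : ℝ}

lemma mem_support_onSubspace {μ : Measure X} {S : Set X} (hS : MeasurableSet S) (h : μ Sᶜ = 0)
    {x : S} (hx : (x : X) ∈ μ.support) : x ∈ (onSubspace μ S).support := by
  refine (Metric.nhds_basis_ball.mem_measureSupport).2 fun r hr => ?_
  have h1 := (Measure.mem_support_iff_forall (x : X)).1 hx _ (Metric.ball_mem_nhds _ hr)
  rwa [← map_onSubspace hS h, Measure.map_apply measurable_subtype_coe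
    Metric.isOpen_ball.measurableSet] at h1

/-- For `u = d(·, o)` almost every ray issues from `o` and satisfies `CD(K,N)`, hence `MCP(K,N)`
with respect to `o`; the disintegration is unchanged. -/
lemma CD1u.mcp1u [CompleteSpace X] [SecondCountableTopology X] (hN : 1 < N) {m : Measure X}
    {o : X} (h : CD1u K N m fun x => dist x o) : MCP1u K N m o := by
  obtain ⟨Q, hQ, q, Xα, mα, hd, hcd⟩ := h
  refine ⟨Q, hQ, q, Xα, mα, hd, ?_⟩
  filter_upwards [hd.ray, hd.support, hd.concentrated, hcd] with a hray hsupp hconc hcd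
  obtain ⟨ho, hR⟩ := hray.mem_and_isRayFrom
  have hcl : IsClosed (Xα a) := hsupp ▸ Measure.isClosed_support
  have := hd.prob a
  have := isProbabilityMeasure_onSubspace hcl.measurableSet hconc
  have : CompleteSpace (Xα a) := hcl.completeSpace_coe
  have hR' : IsRayFrom (⟨o, ho⟩ : Xα a) univ := by
    refine ⟨fun x _ y _ => hR.dist_eq x x.2 y y.2, fun x _ s hs => ?_⟩
    obtain ⟨y, hy, hys⟩ := hR.exists_dist_eq x x.2 s hs
    exact ⟨⟨y, hy⟩, mem_univ _, hys⟩
  exact ⟨ho, hR'.mcpAt_of_cd hN hcd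
    (mem_support_onSubspace hcl.measurableSet hconc (hsupp.symm ▸ ho))⟩

lemma CD1Lip.cd1 {Y : Type u} [MetricSpace Y] [MeasurableSpace Y] {m : Measure Y}
    (h : CD1Lip K N m) : CD1 K N m :=
  fun f _ _ hf => h (signedDist f) hf

lemma signedDist_dist {Y : Type u} [MetricSpace Y] (o : Y) :
    signedDist (fun x => dist x o) = fun x => dist x o := by
  ext x
  have hset : {y | dist y o = 0} = {o} := by
    ext y
    simp
  rw [signedDist, hset, Metric.infDist_singleton]
  rcases eq_or_ne x o with rfl | hx
  · simp
  · rw [Real.sign_of_pos (dist_pos.2 hx), one_mul]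

/-- The distance from a point is its own signed distance function. -/
lemma CD1.mcp1 [CompleteSpace X] [SecondCountableTopology X] (hN : 1 < N) {m : Measure X}
    (h : CD1 K N m) : MCP1 K N m := by
  intro o
  have : CompleteSpace m.support := Measure.isClosed_support.completeSpace_coe
  have hlip : LipschitzWith 1 fun x : m.support => dist x o := LipschitzWith.dist_left o
  have := h (fun x => dist x o) hlip.continuous ⟨o, dist_self o⟩ (by rwa [signedDist_dist])
  rw [signedDist_dist] at this
  exact this.mcp1u hN

end Implications

end MMS

theorem propositionP {X : Type u} [MetricSpace X] [CompleteSpace X]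
    [TopologicalSpace.SeparableSpace X] [MeasurableSpace X] [BorelSpace X]
    (m : Measure X) [IsProbabilityMeasure m] (K N : ℝ) (hN : 1 < N) :
    (MMS.MCP1 K N m → MMS.MCPeps K N m) ∧
    (MMS.CD1 K N m → MMS.MCP1 K N m ∧ MMS.MCPeps K N m) ∧
    (MMS.CD1Lip K N m → MMS.MCP1 K N m ∧ MMS.MCPeps K N m) := by
  have : SecondCountableTopology X := UniformSpace.secondCountable_of_separable X
  have h (hc : MMS.CD1 K N m) : MMS.MCP1 K N m ∧ MMS.MCPeps K N m :=
    ⟨hc.mcp1 hN, (hc.mcp1 hN).mcpEps hN⟩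
  exact ⟨fun h => h.mcpEps hN, h, fun hl => h hl.cd1⟩
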